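/- Let $d\ge 1$ be an integer, let $V_d$ be the complex vector space of binary forms of degree $d$ with the natural action of $SL(2,\mathbb C)$, and let $\mathcal C_d=\mathbb C[V_d\oplus\mathbb C^2]^{SL(2,\mathbb C)}$ be the algebra of covariants of the binary form of degree $d$, bigraded by degree $i$ (the degree in the coefficients of the form) and order $j$ (the degree in the coordinates of $\mathbb C^2$). Let $$\mathcal P_d(z,t)=\sum_{i,j\ge 0}\dim\big((\mathcal C_d)_{i,j}\big)\,z^i t^j\in\mathbb Z[[z,t]]$$ be its bivariate Poincaré series. For $n\ge 1$ let $\psi_n:\mathbb Z[[t]]\to\mathbb Z[[z,t]]$ be the linear map, applied to power series term by term, with $\psi_n(t^{ni-j})=z^i t^j$ for all integers $i\ge 0$, $0\le j<n$ with $ni-j\ge 0$; that is, $$\psi_n\Big(\sum_{m\ge 0}a_m t^m\Big)=\sum_{\substack{i\ge 0,\ 0\le j<n\\ ni-j\ge 0}}a_{ni-j}\,z^i t^j .$$ Let $(a;q)_n=(1-a)(1-aq)\cdots(1-aq^{n-1})$, with $(a;q)_0=1$. Then, in $\mathbb Z[[z,t]]$, $$\mathcal P_d(z,t)=\sum_{0\le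 k<d/2}\psi_{d-2k}\!\left(\frac{(-1)^k\,t^{k(k+1)}\,(1-t^2)}{(t^2;t^2)_k\,(t^2;t^2)_{d-k}}\right)\frac{1}{1-z\,t^{d-2k}} .$$ -/

import Mathlib

open scoped MatrixGroups

/-- The natural representation of `SL(2, ℂ)` on the space of binary forms of degree `d`, that is,
homogeneous polynomials of degree `d` in two variables: `(g • F)(x) = F(g⁻¹ x)`. -/
noncomputable def formRep (d : ℕ) :
    Representation ℂ SL(2, ℂ) (MvPolynomial.homogeneousSubmodule (Fin 2) ℂ d) where
  toFun g := (MvPolynomial.bind₁ (fun i : Fin 2 =>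
      ∑ j : Fin 2, MvPolynomial.C ((g⁻¹ : SL(2, ℂ)) i j) * MvPolynomial.X j)).toLinearMap.restrict
    (fun F hF => by
      rw [MvPolynomial.mem_homogeneousSubmodule] at hF ⊢
      have h := hF.aeval (fun i : Fin 2 =>
        ∑ j : Fin 2, MvPolynomial.C ((g⁻¹ : SL(2, ℂ)) i j) * MvPolynomial.X j) (n := 1)
        (fun i => MvPolynomial.IsHomogeneous.sum _ _ _ fun j _ => by
          simpa using (MvPolynomial.isHomogeneous_C (Fin 2) ((g⁻¹ : SL(2, ℂ)) i j)).mul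
            (MvPolynomial.isHomogeneous_X ℂ j))
      simpa using h)
  map_one' := by
    ext F : 2
    have h : (fun i : Fin 2 => ∑ j : Fin 2,
        (MvPolynomial.C ((1 : SL(2, ℂ)) i j) * MvPolynomial.X j : MvPolynomial (Fin 2) ℂ)) =
        MvPolynomial.X := by
      funext i
      fin_cases i <;> simp
    simp only [inv_one, LinearMap.coe_restrict_apply, AlgHom.toLinearMap_apply, h,
      Module.End.one_apply]
    simp
  map_mul' g₁ g₂ := by
    ext F : 2
    simp only [LinearMap.coe_restrict_apply, AlgHom.toLinearMap_apply, Module.End.mul_apply,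
      MvPolynomial.bind₁_bind₁]
    congr 2
    funext i
    simp only [mul_inv_rev, Matrix.SpecialLinearGroup.coe_mul, Matrix.mul_apply, Fin.sum_univ_two,
      map_add, map_mul, MvPolynomial.bind₁_X_right, MvPolynomial.bind₁_C_right]
    ring

/-- The coordinate ring `ℂ[V_d ⊕ ℂ²]`: polynomials in the `d + 1` coefficients of a binary form
of degree `d` and the two coordinates of a vector. -/
abbrev CoordRing (d : ℕ) : Type := MvPolynomial (Fin (d + 1) ⊕ Fin 2) ℂ

/-- Evaluation of an element of `ℂ[V_d ⊕ ℂ²]` at a pair `(F, v)`. The `k`-th coordinate of `F` is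
its coefficient at `x ^ (d - k) * y ^ k`. -/
noncomputable def evalAt {d : ℕ} (F : MvPolynomial.homogeneousSubmodule (Fin 2) ℂ d)
    (v : Fin 2 → ℂ) : CoordRing d →ₐ[ℂ] ℂ :=
  MvPolynomial.aeval (Sum.elim
    (fun k : Fin (d + 1) => MvPolynomial.coeff
      (Finsupp.single 0 (d - (k : ℕ)) + Finsupp.single 1 (k : ℕ)) (F : MvPolynomial (Fin 2) ℂ)) v)

/-- The algebra of covariants `ℂ[V_d ⊕ ℂ²]^{SL(2, ℂ)}` of the binary form of degree `d`. -/
noncomputable def covariants (d : ℕ) : Subalgebra ℂ (CoordRing d) where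
  carrier := {p | ∀ (g : SL(2, ℂ)) (F : MvPolynomial.homogeneousSubmodule (Fin 2) ℂ d)
    (v : Fin 2 → ℂ), evalAt (formRep d g F) (g.1.mulVec v) p = evalAt F v p}
  mul_mem' hp hq g F v := by simp only [map_mul, hp g F v, hq g F v]
  add_mem' hp hq g F v := by simp only [map_add, hp g F v, hq g F v]
  algebraMap_mem' r g F v := by simp only [AlgHom.commutes]

/-- The space `(C_d)_{i,j}` of covariants of degree `i` (in the coefficients of the form) and
order `j` (the degree in the two coordinates of the vector). -/
noncomputable def covariantsPart (d i j : ℕ) : Submodule ℂ (CoordRing d) :=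
  Subalgebra.toSubmodule (covariants d) ⊓
    MvPolynomial.weightedHomogeneousSubmodule ℂ
      (Sum.elim (fun _ => (1, 0)) (fun _ => (0, 1)) : Fin (d + 1) ⊕ Fin 2 → ℕ × ℕ) (i, j)

/-- The spaces `(C_d)_{i,j}` are finite-dimensional, so that `Module.finrank` is their genuine
dimension. -/
instance covariantsPart_finiteDimensional (d i j : ℕ) :
    FiniteDimensional ℂ (covariantsPart d i j) := by
  have hle : covariantsPart d i j ≤ MvPolynomial.weightedHomogeneousSubmodule ℂ
      (fun _ : Fin (d + 1) ⊕ Fin 2 => 1) (i + j) := by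
    intro p hp m hm
    have h : Finsupp.weight (Sum.elim (fun _ => (1, 0)) (fun _ => (0, 1)) :
        Fin (d + 1) ⊕ Fin 2 → ℕ × ℕ) m = (i, j) := hp.2 hm
    rw [Finsupp.weight_apply, Finsupp.sum_fintype _ _ (by simp)] at h ⊢
    have h₁ := congrArg Prod.fst h
    have h₂ := congrArg Prod.snd h
    simp only [Fintype.sum_sum_type, Sum.elim_inl, Sum.elim_inr, Prod.fst_add, Prod.snd_add,
      Prod.fst_sum, Prod.snd_sum, Prod.smul_fst, Prod.smul_snd, smul_eq_mul, mul_one, mul_zero,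
      Finset.sum_const_zero, add_zero, zero_add] at h₁ h₂
    simp only [Fintype.sum_sum_type, smul_eq_mul, mul_one, h₁, h₂]
  have hfin : FiniteDimensional ℂ (MvPolynomial.weightedHomogeneousSubmodule ℂ
      (fun _ : Fin (d + 1) ⊕ Fin 2 => 1) (i + j)) := by
    exact Module.Finite.iff_fg.mpr
      (MvPolynomial.weightedHomogeneousSubmodule_fg ℂ _ (fun _ => one_ne_zero) _)
  exact Submodule.finiteDimensional_of_le hle

/-- The bivariate Poincaré series `∑ dim (C_d)_{i,j} z^i t^j` in `ℤ⟦z, t⟧`; the variable with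
index `0` is `z`, the one with index `1` is `t`. -/
noncomputable def poincareSeries (d : ℕ) : MvPowerSeries (Fin 2) ℤ :=
  fun m => (Module.finrank ℂ (covariantsPart d (m 0) (m 1)) : ℤ)

/-- The linear map `ψ_n : ℤ⟦t⟧ → ℤ⟦z, t⟧` with `ψ_n (t^(n i - j)) = z^i t^j` for `0 ≤ j < n`,
applied to series term by term: the coefficient of `ψ_n (∑ a_m t^m)` at `z^i t^j` is
`a_(n i - j)` if `j < n` and `n i - j ≥ 0`, and it is `0` otherwise. -/
noncomputable def psi (n : ℕ) : PowerSeries ℤ →ₗ[ℤ] MvPowerSeries (Fin 2) ℤ where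
  toFun R := fun m =>
    if m 1 < n ∧ m 1 ≤ n * m 0 then PowerSeries.coeff (n * m 0 - m 1) R else 0
  map_add' R S := by
    ext m
    change (if m 1 < n ∧ m 1 ≤ n * m 0 then PowerSeries.coeff (n * m 0 - m 1) (R + S) else 0) =
      (if m 1 < n ∧ m 1 ≤ n * m 0 then PowerSeries.coeff (n * m 0 - m 1) R else 0) +
      (if m 1 < n ∧ m 1 ≤ n * m 0 then PowerSeries.coeff (n * m 0 - m 1) S else 0)
    split_ifs <;> simp
  map_smul' c R := by
    ext m
    change (if m 1 < n ∧ m 1 ≤ n * m 0 then PowerSeries.coeff (n * m 0 - m 1) (c • R) else 0) =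
      MvPowerSeries.coeff m (c • (fun m => if m 1 < n ∧ m 1 ≤ n * m 0 then
        PowerSeries.coeff (n * m 0 - m 1) R else 0 : MvPowerSeries (Fin 2) ℤ))
    rw [map_zsmul]
    change _ = c • (if m 1 < n ∧ m 1 ≤ n * m 0 then PowerSeries.coeff (n * m 0 - m 1) R else 0)
    split_ifs
    · exact map_zsmul (PowerSeries.coeff (R := ℤ) (n * m 0 - m 1)) c R
    · exact (smul_zero c).symm

/-- The coefficients of `ψ_n`. -/
theorem coeff_psi (n : ℕ) (R : PowerSeries ℤ) (m : Fin 2 →₀ ℕ) :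
    MvPowerSeries.coeff m (psi n R) =
      if m 1 < n ∧ m 1 ≤ n * m 0 then PowerSeries.coeff (n * m 0 - m 1) R else 0 :=
  rfl

/-- The defining rule of `ψ_n`. -/
theorem psi_X_pow (n i j : ℕ) (hj : j < n) (hij : j ≤ n * i) :
    psi n (PowerSeries.X ^ (n * i - j)) = MvPowerSeries.X 0 ^ i * MvPowerSeries.X 1 ^ j := by
  ext m
  rw [coeff_psi, PowerSeries.coeff_X_pow, MvPowerSeries.X_pow_eq, MvPowerSeries.X_pow_eq,
    MvPowerSeries.monomial_mul_monomial, MvPowerSeries.coeff_monomial, ← ite_and, one_mul]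
  have key : ((m 1 < n ∧ m 1 ≤ n * m 0) ∧ n * m 0 - m 1 = n * i - j) ↔
      m = Finsupp.single 0 i + Finsupp.single 1 j := by
    constructor
    · rintro ⟨⟨h₁, h₂⟩, h₃⟩
      have h₄ : n * m 0 + j = n * i + m 1 := by omega
      have h₅ : m 1 = j := by
        have := congrArg (· % n) h₄
        simpa [Nat.mul_add_mod, Nat.mod_eq_of_lt hj, Nat.mod_eq_of_lt h₁] using this.symm
      have h₆ : m 0 = i := by
        rw [h₅] at h₄
        exact Nat.eq_of_mul_eq_mul_left (by omega : 0 < n) (by omega)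
      ext x
      fin_cases x <;> simp [h₅, h₆]
    · rintro rfl
      simp [hj, hij]
  simp only [key]

/-- The `q`-shifted factorial `(a; q)_n = (1 - a) (1 - a q) ⋯ (1 - a q^(n-1))`. -/
noncomputable def qShiftedFactorial (a q : PowerSeries ℤ) (n : ℕ) : PowerSeries ℤ :=
  ∏ i ∈ Finset.range n, (1 - a * q ^ i)

/-- The denominators are invertible in `ℤ⟦t⟧`, so that `PowerSeries.invOfUnit _ 1` is their
genuine inverse. -/
theorem constantCoeff_qShiftedFactorial (n : ℕ) :
    PowerSeries.constantCoeff
      (qShiftedFactorial (PowerSeries.X ^ 2) (PowerSeries.X ^ 2) n) = 1 := by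
  simp [qShiftedFactorial, map_prod]

/-! The group is generated by its two unipotent one-parameter subgroups, so the covariants are the
polynomials killed by the two derivations `lowering` and `raising`. With `weightOp` these form an
`sl₂`-triple on ℂ[V_d ⊕ ℂ²] that preserves degree and order. A covariant of bidegree (i, j) is then
a weight-zero vector killed by `lowering`. Since `lowering` maps weight 0 onto weight -2, the
dimension sought is dim W_0 - dim W_{-2} (`finrank_covariantsPart`).

Both dimensions count monomials. Summing over the exponents of the two vector coordinates
telescopes, and the symmetry of the Gaussian binomials turns the difference into the coefficient of
t^(di-j) in (1 - t²) G_i, where G_i (`tupleSeries`) is the coefficient of z^i in ∏_{k=0}^{d} 1/(1 -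
z t^(2k)).

Partial fractions in z give G_i = ∑_k r_k t^(2ki), where r_k = (-1)^k t^(k(k+1)) / ((t²;t²)_k
(t²;t²)_(d-k)) (`tupleSeries_eq_residueSum`). The k-th term contributes the coefficient of
t^((d-2k)i-j) in (1 - t²) r_k. For k ≥ d/2 the power of t is already too large. For k < d/2,
collecting these coefficients over all i and j gives ψ_{d-2k} times a geometric series
(`psi_mul_invOfUnit`). -/

/-! ### Weight vectors of an `sl₂`-triple. -/

section Sl2

variable {V : Type*} [AddCommGroup V] [Module ℂ V]

/-- The commutation rule of an `sl₂`-triple on a weight vector. -/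
theorem raise_lower_pow {e f h : V →ₗ[ℂ] V} (hef : ∀ x, e (f x) - f (e x) = h x)
    (hhf : ∀ x, h (f x) - f (h x) = (-2 : ℂ) • f x) {x : V} {μ : ℂ} (hx : h x = μ • x) (n : ℕ) :
    h ((f ^ n) x) = (μ - 2 * n) • (f ^ n) x ∧
    e ((f ^ (n + 1)) x) = (f ^ (n + 1)) (e x) + ((n + 1) * (μ - n)) • (f ^ n) x := by
  have hw : ∀ n : ℕ, h ((f ^ n) x) = (μ - 2 * n) • (f ^ n) x := by
    intro n
    induction n with
    | zero => simpa using hx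
    | succ n ih =>
      rw [pow_succ', Module.End.mul_apply, sub_eq_iff_eq_add.1 (hhf _), ih, map_smul, ← add_smul]
      push_cast
      ring_nf
  refine ⟨hw n, ?_⟩
  induction n with
  | zero =>
    have := sub_eq_iff_eq_add.1 (hef x)
    simp [this, hx, add_comm]
  | succ n ih =>
    rw [pow_succ' f (n + 1), Module.End.mul_apply, sub_eq_iff_eq_add.1 (hef _), ih, hw,
      map_add, map_smul, Module.End.mul_apply, ← Module.End.mul_apply f (f ^ n), ← pow_succ']
    push_cast
    module

/-- If `f` acts nilpotently on a weight vector of weight `μ` with `f (e x) = 0`, then `f ^ k`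
kills it as soon as `μ` is not one of the natural numbers `n ≥ k`. -/
theorem lower_pow_eq_zero {e f h : V →ₗ[ℂ] V} (hef : ∀ x, e (f x) - f (e x) = h x)
    (hhf : ∀ x, h (f x) - f (h x) = (-2 : ℂ) • f x) {x : V} {μ : ℂ} (hx : h x = μ • x)
    (hfe : f (e x) = 0) (k : ℕ) (hμ : ∀ n : ℕ, k ≤ n → μ ≠ n) {N : ℕ} (hN : (f ^ N) x = 0) :
    (f ^ k) x = 0 := by
  have step : ∀ m, (f ^ (k + m)) x = 0 → (f ^ k) x = 0 := by
    intro m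
    induction m with
    | zero => exact id
    | succ m ih =>
      intro hm
      apply ih
      -- With n = k + m, applying `e` to `f ^ (n + 1) x = 0` leaves (n + 1)(μ - n) `f ^ n x` = 0,
      -- and the scalar is nonzero.
      have h₂ := (raise_lower_pow hef hhf hx (k + m)).2
      rw [← add_assoc] at hm
      rw [hm, map_zero, pow_succ, Module.End.mul_apply, hfe, map_zero, zero_add] at h₂
      refine (smul_eq_zero.1 h₂.symm).resolve_left (mul_ne_zero (Nat.cast_add_one_ne_zero _) ?_)
      exact sub_ne_zero.2 (hμ _ (by omega))
  refine step N ?_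
  rw [pow_add, Module.End.mul_apply, hN, map_zero]

end Sl2

/-! ### Derivations of polynomial rings and one-parameter groups of substitutions. -/

namespace MvPolynomial

variable {σ : Type*}

/-- A derivation that shifts the weights of the variables shifts weighted degrees. -/
theorem isWeightedHomogeneous_derivation {M : Type*} [AddCommMonoid M] {w : σ → M} {δ : M}
    (D : Derivation ℂ (MvPolynomial σ ℂ) (MvPolynomial σ ℂ))
    (hD : ∀ i, IsWeightedHomogeneous w (D (X i)) (w i + δ)) {p : MvPolynomial σ ℂ} {n : M}
    (hp : IsWeightedHomogeneous w p n) : IsWeightedHomogeneous w (D p) (n + δ) := by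
  have hm : ∀ (s : σ →₀ ℕ) (c : ℂ),
      IsWeightedHomogeneous w (D (monomial s c)) (Finsupp.weight w s + δ) := by
    intro s c
    induction s using Finsupp.induction_linear generalizing c with
    | zero =>
      rw [← C_apply, ← algebraMap_eq, Derivation.map_algebraMap]
      exact isWeightedHomogeneous_zero _ _ _
    | add s t hs ht =>
      have : monomial (s + t) c = monomial s c * monomial t 1 := by simp
      rw [this, Derivation.leibniz, smul_eq_mul, smul_eq_mul, map_add]
      refine IsWeightedHomogeneous.add ?_ ?_
      · rw [add_assoc]
        exact (isWeightedHomogeneous_monomial w s c rfl).mul (ht 1)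
      · rw [add_comm (Finsupp.weight w s), add_assoc]
        exact (isWeightedHomogeneous_monomial w t 1 rfl).mul (hs c)
    | single i k =>
      have : monomial (Finsupp.single i k) c = C c * X i ^ k := by
        rw [X_pow_eq_monomial, C_mul_monomial, mul_one]
      rw [this, Derivation.leibniz, Derivation.leibniz_pow]
      simp only [← algebraMap_eq, Derivation.map_algebraMap, smul_eq_mul]
      rw [algebraMap_eq, nsmul_eq_mul]
      -- The exponent k - 1 from the Leibniz rule is truncated at k = 0, where its coefficient
      -- vanishes.
      rcases k with _ | k
      · simpa using isWeightedHomogeneous_zero _ _ _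
      · have h₁ := (((isWeightedHomogeneous_X ℂ w i).pow k).mul (hD i))
        have h₂ := (isWeightedHomogeneous_C w c).mul
          ((isWeightedHomogeneous_C w ((k + 1 : ℕ) : ℂ)).mul h₁)
        convert h₂ using 1
        · simp
        · rw [Finsupp.weight_single, zero_add, zero_add, succ_nsmul, add_assoc]
  rw [p.as_sum, map_sum]
  refine IsWeightedHomogeneous.sum _ _ _ fun s hs => ?_
  rw [← hp (mem_support_iff.1 hs)]
  exact hm _ _

/-- A diagonal derivation multiplies each monomial by its weight. -/
theorem coeff_derivation_diagonal
    (D : Derivation ℂ (MvPolynomial σ ℂ) (MvPolynomial σ ℂ)) (w : σ → ℤ)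
    (hD : ∀ i, D (X i) = (w i : ℂ) • X i) (p : MvPolynomial σ ℂ) (s : σ →₀ ℕ) :
    coeff s (D p) = (Finsupp.weight w s : ℂ) * coeff s p := by
  have hm : ∀ (s : σ →₀ ℕ) (c : ℂ),
      D (monomial s c) = ((Finsupp.weight w s : ℤ) : ℂ) • monomial s c := by
    intro s c
    induction s using Finsupp.induction_linear generalizing c with
    | zero =>
      rw [← C_apply, ← algebraMap_eq, Derivation.map_algebraMap]
      simp
    | add s t hs ht =>
      have : monomial (s + t) c = monomial s c * monomial t 1 := by simp
      rw [this, Derivation.leibniz, smul_eq_mul, smul_eq_mul, map_add, hs, ht, mul_smul_comm,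
        mul_smul_comm, mul_comm (monomial t 1), ← add_smul]
      push_cast
      rw [add_comm]
    | single i k =>
      have : monomial (Finsupp.single i k) c = C c * X i ^ k := by
        rw [X_pow_eq_monomial, C_mul_monomial, mul_one]
      rw [this, Derivation.leibniz, Derivation.leibniz_pow]
      simp only [← algebraMap_eq, Derivation.map_algebraMap, smul_eq_mul]
      rcases k with _ | k
      · simp
      · simp only [hD, Finsupp.weight_single, algebraMap_eq, smul_eq_C_mul, nsmul_eq_mul]
        push_cast
        simp only [map_mul, map_add, map_one, map_natCast]
        ring
  classical
  induction p using MvPolynomial.induction_on' with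
  | monomial u a =>
    rw [hm, coeff_smul, coeff_monomial]
    split_ifs with h
    · rw [h, smul_eq_mul]
    · simp
  | add p q hp hq => rw [map_add, coeff_add, coeff_add, hp, hq, mul_add]

/-- The dimension of a weighted homogeneous component is the number of its monomials. -/
theorem finrank_weightedHomogeneousSubmodule {M : Type*} [AddCommMonoid M] (w : σ → M) (n : M) :
    Module.finrank ℂ (weightedHomogeneousSubmodule ℂ w n) =
      Nat.card {s : σ →₀ ℕ // Finsupp.weight w s = n} := by
  rw [weightedHomogeneousSubmodule_eq_finsupp_supported]
  exact Module.finrank_eq_nat_card_basis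
    (basisRestrictSupport ℂ {s : σ →₀ ℕ | Finsupp.weight w s = n})

/-- A one-parameter family of substitutions whose derivative is given by a derivation. -/
theorem derivative_substitution (D : Derivation ℂ (MvPolynomial σ ℂ) (MvPolynomial σ ℂ))
    (Φ : MvPolynomial σ ℂ →ₐ[ℂ] Polynomial (MvPolynomial σ ℂ))
    (hΦ : ∀ i, Polynomial.derivative (Φ (X i)) = Φ (D (X i))) (p : MvPolynomial σ ℂ) :
    Polynomial.derivative (Φ p) = Φ (D p) := by
  induction p using MvPolynomial.induction_on with
  | C a =>
    rw [← algebraMap_eq, AlgHom.commutes, Derivation.map_algebraMap, map_zero,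
      IsScalarTower.algebraMap_apply ℂ (MvPolynomial σ ℂ) (Polynomial (MvPolynomial σ ℂ)),
      Polynomial.algebraMap_eq, Polynomial.derivative_C]
  | add p q hp hq => simp only [map_add, hp, hq]
  | mul_X p i hp =>
    rw [map_mul, Polynomial.derivative_mul, hp, hΦ, Derivation.leibniz]
    simp only [smul_eq_mul, map_add, map_mul]
    ring

/-- A polynomial is invariant under a one-parameter group of substitutions if and only if it is
killed by the infinitesimal generator. -/
theorem invariant_iff_derivation_eq_zero
    (D : Derivation ℂ (MvPolynomial σ ℂ) (MvPolynomial σ ℂ))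
    (Φ : MvPolynomial σ ℂ →ₐ[ℂ] Polynomial (MvPolynomial σ ℂ))
    (hΦ : ∀ i, Polynomial.derivative (Φ (X i)) = Φ (D (X i)))
    (h0 : ∀ i, (Φ (X i)).eval 0 = X i) (p : MvPolynomial σ ℂ) :
    (∀ s : ℂ, (Φ p).eval (C s) = p) ↔ D p = 0 := by
  have hz : ∀ q, (Φ q).eval 0 = q := by
    intro q
    have : ((Polynomial.aeval (R := MvPolynomial σ ℂ) (0 : MvPolynomial σ ℂ)).restrictScalars
        ℂ).comp Φ = AlgHom.id ℂ _ := by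
      apply MvPolynomial.algHom_ext
      intro i
      simpa [Polynomial.aeval_def, Polynomial.eval₂_eq_eval_map] using h0 i
    simpa [Polynomial.aeval_def, Polynomial.eval₂_eq_eval_map] using DFunLike.congr_fun this q
  constructor
  · intro h
    -- A polynomial in the parameter taking the value p at infinitely many points is constant; its
    -- derivative at 0 is `D p`.
    have hc : Φ p = Polynomial.C p := by
      refine Polynomial.eq_of_infinite_eval_eq _ _ ?_
      refine Set.Infinite.mono ?_ (Set.infinite_range_of_injective (C_injective σ ℂ))
      rintro _ ⟨s, rfl⟩
      simpa using h s
    have := derivative_substitution D Φ hΦ p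
    rw [hc, Polynomial.derivative_C] at this
    rw [← hz (D p), ← this, Polynomial.eval_zero]
  · intro h s
    have h₁ := derivative_substitution D Φ hΦ p
    rw [h, map_zero] at h₁
    -- In characteristic zero a vanishing derivative forces a constant, here the value p at
    -- parameter 0.
    have h₂ := Polynomial.eq_C_of_derivative_eq_zero h₁
    have h₃ := hz p
    rw [h₂, Polynomial.eval_C] at h₃ ⊢
    exact h₃

end MvPolynomial

/-! ### The `sl₂`-triple acting on the coordinate ring. -/

section

open MvPolynomial

/-- The coordinate of a form at `x ^ (d - n) * y ^ n`, extended by zero to all `n`. -/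
noncomputable def formCoord (d n : ℕ) : CoordRing d :=
  if h : n < d + 1 then X (Sum.inl ⟨n, h⟩) else 0

theorem formCoord_fin (d : ℕ) (k : Fin (d + 1)) : formCoord d k = X (Sum.inl k) :=
  dif_pos k.2

theorem formCoord_of_lt {d n : ℕ} (h : d < n) : formCoord d n = 0 := by
  simp [formCoord, not_lt.2 (Nat.succ_le_of_lt h)]

/-- The infinitesimal action of the upper unipotent matrices. -/
noncomputable def lowering (d : ℕ) : Derivation ℂ (CoordRing d) (CoordRing d) :=
  mkDerivation ℂ (Sum.elim
    (fun k => (-((d : ℂ) - k + 1)) • if (k : ℕ) = 0 then 0 else formCoord d (k - 1))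
    ![X (Sum.inr 1), 0])

/-- The infinitesimal action of the lower unipotent matrices. -/
noncomputable def raising (d : ℕ) : Derivation ℂ (CoordRing d) (CoordRing d) :=
  mkDerivation ℂ (Sum.elim (fun k => (-((k : ℂ) + 1)) • formCoord d (k + 1))
    ![0, X (Sum.inr 0)])

/-- The weights of the coordinates with respect to the diagonal torus. -/
def torusWeight (d : ℕ) : Fin (d + 1) ⊕ Fin 2 → ℤ :=
  Sum.elim (fun k => 2 * k - d) ![1, -1]

/-- The infinitesimal action of the diagonal matrices. -/
noncomputable def weightOp (d : ℕ) : Derivation ℂ (CoordRing d) (CoordRing d) :=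
  mkDerivation ℂ (fun i => (torusWeight d i : ℂ) • X i)

theorem weightOp_X (d : ℕ) (i : Fin (d + 1) ⊕ Fin 2) :
    weightOp d (X i) = (torusWeight d i : ℂ) • X i :=
  mkDerivation_X _ _ _

theorem lowering_formCoord_zero (d : ℕ) : lowering d (formCoord d 0) = 0 := by
  rw [← Fin.val_zero (d + 1), formCoord_fin, lowering, mkDerivation_X]
  simp

/-- No bound on n is needed: at n = d the factor d - n vanishes, and beyond it both coordinates are
zero. -/
theorem lowering_formCoord_succ (d n : ℕ) :
    lowering d (formCoord d (n + 1)) = (-((d : ℂ) - n)) • formCoord d n := by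
  rcases lt_trichotomy n d with h | rfl | h
  · have : formCoord d (n + 1) = X (Sum.inl ⟨n + 1, by omega⟩) := by simp [formCoord, h]
    rw [this, lowering, mkDerivation_X]
    simp only [Sum.elim_inl, Nat.succ_ne_zero, if_false, Nat.add_sub_cancel]
    push_cast
    module
  · simp [formCoord_of_lt (Nat.lt_succ_self n)]
  · simp [formCoord_of_lt h, formCoord_of_lt (h.trans (Nat.lt_succ_self n))]

theorem raising_formCoord (d n : ℕ) :
    raising d (formCoord d n) = (-((n : ℂ) + 1)) • formCoord d (n + 1) := by
  rcases lt_or_ge n (d + 1) with h | h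
  · have : formCoord d n = X (Sum.inl ⟨n, h⟩) := by simp [formCoord, h]
    rw [this, raising, mkDerivation_X]
    simp
  · rw [formCoord_of_lt h, formCoord_of_lt (Nat.lt_succ_of_lt h)]
    simp

theorem weightOp_formCoord (d n : ℕ) :
    weightOp d (formCoord d n) = (2 * n - d : ℂ) • formCoord d n := by
  rcases lt_or_ge n (d + 1) with h | h
  · have : formCoord d n = X (Sum.inl ⟨n, h⟩) := by simp [formCoord, h]
    rw [this, weightOp_X]
    simp [torusWeight]
  · rw [formCoord_of_lt h]
    simp

theorem lowering_inr_zero (d : ℕ) : lowering d (X (Sum.inr 0)) = X (Sum.inr 1) := by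
  simp [lowering, mkDerivation_X]

theorem lowering_inr_one (d : ℕ) : lowering d (X (Sum.inr 1)) = 0 := by
  simp [lowering, mkDerivation_X]

theorem raising_inr_zero (d : ℕ) : raising d (X (Sum.inr 0)) = 0 := by
  simp [raising, mkDerivation_X]

theorem raising_inr_one (d : ℕ) : raising d (X (Sum.inr 1)) = X (Sum.inr 0) := by
  simp [raising, mkDerivation_X]

theorem weightOp_inr_zero (d : ℕ) : weightOp d (X (Sum.inr 0)) = X (Sum.inr 0) := by
  simp [weightOp_X, torusWeight]

theorem weightOp_inr_one (d : ℕ) : weightOp d (X (Sum.inr 1)) = -X (Sum.inr 1) := by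
  simp [weightOp_X, torusWeight]

/-- A commutator of derivations is a derivation, so this relation and the next two need checking
only on the variables. -/
theorem raising_lowering_sub (d : ℕ) (p : CoordRing d) :
    raising d (lowering d p) - lowering d (raising d p) = weightOp d p := by
  have : ⁅raising d, lowering d⁆ = weightOp d := by
    apply derivation_ext
    rintro (k | k)
    · rw [← formCoord_fin, Derivation.commutator_apply, raising_formCoord, weightOp_formCoord]
      obtain ⟨k, hk⟩ := k
      rcases k with _ | k
      · simp only [lowering_formCoord_zero, map_zero, Derivation.map_smul,
          lowering_formCoord_succ]
        push_cast
        module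
      · simp only [Derivation.map_smul, lowering_formCoord_succ, raising_formCoord]
        push_cast
        module
    · rw [Derivation.commutator_apply]
      fin_cases k
      · simp [lowering_inr_zero, raising_inr_zero, raising_inr_one, weightOp_inr_zero]
      · simp [lowering_inr_one, raising_inr_one, lowering_inr_zero, weightOp_inr_one]
  rw [← this, Derivation.commutator_apply]

theorem weightOp_lowering_sub (d : ℕ) (p : CoordRing d) :
    weightOp d (lowering d p) - lowering d (weightOp d p) = (-2 : ℂ) • lowering d p := by
  have : ⁅weightOp d, lowering d⁆ = (-2 : ℂ) • lowering d := by
    apply derivation_ext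
    rintro (k | k)
    · rw [← formCoord_fin, Derivation.commutator_apply, weightOp_formCoord, Derivation.smul_apply]
      obtain ⟨k, hk⟩ := k
      rcases k with _ | k
      · simp [lowering_formCoord_zero]
      · simp only [Derivation.map_smul, lowering_formCoord_succ, weightOp_formCoord]
        push_cast
        module
    · rw [Derivation.commutator_apply, Derivation.smul_apply]
      fin_cases k
      · simp [lowering_inr_zero, weightOp_inr_one, weightOp_inr_zero]
        module
      · simp [lowering_inr_one, weightOp_inr_one]
  rw [← Derivation.smul_apply, ← this, Derivation.commutator_apply]

theorem weightOp_raising_sub (d : ℕ) (p : CoordRing d) :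
    weightOp d (raising d p) - raising d (weightOp d p) = (2 : ℂ) • raising d p := by
  have : ⁅weightOp d, raising d⁆ = (2 : ℂ) • raising d := by
    apply derivation_ext
    rintro (k | k)
    · rw [← formCoord_fin, Derivation.commutator_apply, weightOp_formCoord, Derivation.smul_apply]
      simp only [Derivation.map_smul, raising_formCoord, weightOp_formCoord]
      push_cast
      module
    · rw [Derivation.commutator_apply, Derivation.smul_apply]
      fin_cases k
      · simp [raising_inr_zero, weightOp_inr_zero]
      · simp [raising_inr_one, weightOp_inr_one, weightOp_inr_zero]
        module
  rw [← Derivation.smul_apply, ← this, Derivation.commutator_apply]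

/-! ### Generic unipotent substitutions and their infinitesimal generators. -/

section Unipotent

/-- The substitution by a generic upper unipotent matrix. -/
noncomputable def upperSubst (d : ℕ) : CoordRing d →ₐ[ℂ] Polynomial (CoordRing d) :=
  aeval (Sum.elim
    (fun k : Fin (d + 1) => ∑ l : Fin (d + 1),
      ((d - l : ℕ).choose (d - k) : Polynomial (CoordRing d)) * (-Polynomial.X) ^ ((k : ℕ) - l : ℕ) *
        Polynomial.C (X (Sum.inl l)))
    ![Polynomial.C (X (Sum.inr 0)) + Polynomial.X * Polynomial.C (X (Sum.inr 1)),
      Polynomial.C (X (Sum.inr 1))])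

/-- The substitution by a generic lower unipotent matrix. -/
noncomputable def lowerSubst (d : ℕ) : CoordRing d →ₐ[ℂ] Polynomial (CoordRing d) :=
  aeval (Sum.elim
    (fun k : Fin (d + 1) => ∑ l : Fin (d + 1),
      ((l : ℕ).choose k : Polynomial (CoordRing d)) * (-Polynomial.X) ^ ((l : ℕ) - k : ℕ) *
        Polynomial.C (X (Sum.inl l)))
    ![Polynomial.C (X (Sum.inr 0)),
      Polynomial.C (X (Sum.inr 1)) + Polynomial.X * Polynomial.C (X (Sum.inr 0))])

theorem derivative_neg_X_pow {R : Type*} [CommRing R] (n : ℕ) :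
    Polynomial.derivative ((-Polynomial.X : Polynomial R) ^ n) =
      -((n : Polynomial R) * (-Polynomial.X) ^ (n - 1)) := by
  rw [Polynomial.derivative_pow]
  simp

/-- The bound matters: for n > d the truncated d - n is 0 and every binomial would be 1. In the
lower case the binomials vanish by themselves. -/
theorem upperSubst_formCoord {d n : ℕ} (hn : n ≤ d) :
    upperSubst d (formCoord d n) = ∑ l : Fin (d + 1),
      ((d - l : ℕ).choose (d - n) : Polynomial (CoordRing d)) * (-Polynomial.X) ^ (n - l : ℕ) *
        Polynomial.C (X (Sum.inl l)) := by
  have : formCoord d n = X (Sum.inl ⟨n, by omega⟩) := by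
    simp [formCoord, Nat.lt_succ_of_le hn]
  rw [this, upperSubst, aeval_X]
  simp

theorem lowerSubst_formCoord (d n : ℕ) :
    lowerSubst d (formCoord d n) = ∑ l : Fin (d + 1),
      ((l : ℕ).choose n : Polynomial (CoordRing d)) * (-Polynomial.X) ^ (l - n : ℕ) *
        Polynomial.C (X (Sum.inl l)) := by
  rcases lt_or_ge n (d + 1) with h | h
  · have : formCoord d n = X (Sum.inl ⟨n, h⟩) := by simp [formCoord, h]
    rw [this, lowerSubst, aeval_X]
    simp
  · rw [formCoord_of_lt h, map_zero]
    symm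
    refine Finset.sum_eq_zero fun l _ => ?_
    rw [Nat.choose_eq_zero_of_lt (by omega)]
    simp

theorem derivative_upperSubst_X (d : ℕ) (i : Fin (d + 1) ⊕ Fin 2) :
    Polynomial.derivative (upperSubst d (X i)) = upperSubst d (lowering d (X i)) := by
  rcases i with k | k
  · rw [← formCoord_fin, upperSubst_formCoord (by omega), Polynomial.derivative_sum]
    obtain ⟨k, hk⟩ := k
    rcases k with _ | k
    · simp [lowering_formCoord_zero]
    · simp only [lowering_formCoord_succ, map_smul]
      rw [upperSubst_formCoord (by omega), Finset.smul_sum]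
      refine Finset.sum_congr rfl fun l _ => ?_
      -- The binomial identity whose factor k + 1 - l matches the exponent brought down by
      -- differentiating (-X)^(k+1-l).
      have h := Nat.choose_succ_right_eq (d - l) (d - (k + 1))
      have h₁ : d - (k + 1) + 1 = d - k := by omega
      have h₂ : d - (l : ℕ) - (d - (k + 1)) = k + 1 - l := by omega
      rw [h₁, h₂] at h
      have h₃ := congrArg (Nat.cast : ℕ → Polynomial (CoordRing d)) h
      rw [Nat.cast_mul, Nat.cast_mul, Nat.cast_sub (by omega : k ≤ d)] at h₃
      have h₄ : k + 1 - (l : ℕ) - 1 = k - l := by omega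
      simp only [Polynomial.derivative_mul, derivative_neg_X_pow, Polynomial.derivative_natCast,
        Polynomial.derivative_C, h₄]
      rw [Algebra.smul_def, map_neg, map_sub, map_natCast, map_natCast]
      linear_combination ((-Polynomial.X) ^ (k - (l : ℕ)) *
        Polynomial.C (X (Sum.inl l) : CoordRing d)) * h₃
  · fin_cases k
    · simp [lowering_inr_zero, upperSubst]
    · simp [lowering_inr_one, upperSubst]

theorem derivative_lowerSubst_X (d : ℕ) (i : Fin (d + 1) ⊕ Fin 2) :
    Polynomial.derivative (lowerSubst d (X i)) = lowerSubst d (raising d (X i)) := by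
  rcases i with k | k
  · rw [← formCoord_fin, raising_formCoord, map_smul, lowerSubst_formCoord, lowerSubst_formCoord,
      Polynomial.derivative_sum, Finset.smul_sum]
    refine Finset.sum_congr rfl fun l _ => ?_
    have h₃ := congrArg (Nat.cast : ℕ → Polynomial (CoordRing d))
      (Nat.choose_succ_right_eq l k)
    push_cast at h₃
    simp only [Polynomial.derivative_mul, derivative_neg_X_pow, Polynomial.derivative_natCast,
      Polynomial.derivative_C, Nat.sub_sub]
    rw [Algebra.smul_def, map_neg, map_add, map_natCast, map_one]
    linear_combination ((-Polynomial.X) ^ (l - (k + 1) : ℕ) *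
      Polynomial.C (X (Sum.inl l) : CoordRing d)) * h₃
  · fin_cases k
    · simp [raising_inr_zero, lowerSubst]
    · simp [raising_inr_one, lowerSubst]

theorem eval_zero_upperSubst_X (d : ℕ) (i : Fin (d + 1) ⊕ Fin 2) :
    (upperSubst d (X i)).eval 0 = X i := by
  rcases i with k | k
  · simp only [upperSubst, aeval_X, Sum.elim_inl, Polynomial.eval_finsetSum]
    rw [Finset.sum_eq_single k]
    · simp
    · intro l _ hl
      rcases lt_or_gt_of_ne (Fin.val_ne_of_ne hl) with h | h
      · have : (k : ℕ) - l ≠ 0 := by omega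
        simp [this]
      · rw [Nat.choose_eq_zero_of_lt (by omega)]
        simp
    · simp
  · fin_cases k <;> simp [upperSubst]

theorem eval_zero_lowerSubst_X (d : ℕ) (i : Fin (d + 1) ⊕ Fin 2) :
    (lowerSubst d (X i)).eval 0 = X i := by
  rcases i with k | k
  · simp only [lowerSubst, aeval_X, Sum.elim_inl, Polynomial.eval_finsetSum]
    rw [Finset.sum_eq_single k]
    · simp
    · intro l _ hl
      rcases lt_or_gt_of_ne (Fin.val_ne_of_ne hl) with h | h
      · rw [Nat.choose_eq_zero_of_lt h]
        simp
      · have : (l : ℕ) - k ≠ 0 := by omega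
        simp [this]
    · simp
  · fin_cases k <;> simp [lowerSubst]

end Unipotent

end

/-! ### The group action in coordinates, and covariants as a joint kernel. -/

section

open MvPolynomial

/-- The coefficients of a binary form. -/
noncomputable def formCoeff {d : ℕ} (F : homogeneousSubmodule (Fin 2) ℂ d) (k : ℕ) : ℂ :=
  coeff (Finsupp.single 0 (d - k) + Finsupp.single 1 k) (F : MvPolynomial (Fin 2) ℂ)

theorem single_add_single_inj {a b a' b' : ℕ} :
    (Finsupp.single 0 a + Finsupp.single 1 b : Fin 2 →₀ ℕ) =
      Finsupp.single 0 a' + Finsupp.single 1 b' ↔ a = a' ∧ b = b' := by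
  constructor
  · intro h
    have h₀ := DFunLike.congr_fun h 0
    have h₁ := DFunLike.congr_fun h 1
    simp at h₀ h₁
    exact ⟨h₀, h₁⟩
  · rintro ⟨rfl, rfl⟩
    rfl

theorem coeff_C_mul_X_pow_mul_X_pow (c : ℂ) (a b a' b' : ℕ) :
    coeff (Finsupp.single 0 a' + Finsupp.single 1 b')
      (C c * (X 0 ^ a * X 1 ^ b) : MvPolynomial (Fin 2) ℂ) = if a = a' ∧ b = b' then c else 0 := by
  rw [X_pow_eq_monomial, X_pow_eq_monomial, monomial_mul, C_mul_monomial, coeff_monomial]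
  simp [single_add_single_inj]

theorem form_eq_sum {d : ℕ} (F : homogeneousSubmodule (Fin 2) ℂ d) :
    (F : MvPolynomial (Fin 2) ℂ) =
      ∑ l : Fin (d + 1), C (formCoeff F l) * (X 0 ^ (d - l : ℕ) * X 1 ^ (l : ℕ)) := by
  ext m
  obtain ⟨a, b, rfl⟩ : ∃ a b, m = Finsupp.single 0 a + Finsupp.single 1 b :=
    ⟨m 0, m 1, by ext i; fin_cases i <;> simp⟩
  rw [coeff_sum]
  simp only [coeff_C_mul_X_pow_mul_X_pow]
  by_cases h : a + b = d
  · rw [Finset.sum_eq_single ⟨b, by omega⟩]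
    · have h' : d - b = a := by omega
      simp [formCoeff, h']
    · intro l _ hl
      rw [if_neg]
      rintro ⟨-, rfl⟩
      exact hl rfl
    · simp
  · rw [Finset.sum_eq_zero]
    · refine (F.2 : IsHomogeneous _ d).coeff_eq_zero ?_
      simpa [map_add] using h
    · intro l _
      rw [if_neg]
      omega

/-- The form with prescribed coefficients. -/
noncomputable def formOf {d : ℕ} (c : Fin (d + 1) → ℂ) : homogeneousSubmodule (Fin 2) ℂ d :=
  ⟨∑ l : Fin (d + 1), C (c l) * (X 0 ^ (d - l : ℕ) * X 1 ^ (l : ℕ)), by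
    refine Submodule.sum_mem _ fun l _ => ?_
    rw [mem_homogeneousSubmodule]
    have := (isHomogeneous_C (Fin 2) (c l)).mul
      (((isHomogeneous_X ℂ (0 : Fin 2)).pow (d - l : ℕ)).mul
        ((isHomogeneous_X ℂ (1 : Fin 2)).pow (l : ℕ)))
    convert this using 1
    omega⟩

theorem formCoeff_formOf {d : ℕ} (c : Fin (d + 1) → ℂ) (k : Fin (d + 1)) :
    formCoeff (formOf c) k = c k := by
  rw [formCoeff, formOf, coeff_sum]
  simp only [coeff_C_mul_X_pow_mul_X_pow]
  rw [Finset.sum_eq_single k]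
  · simp
  · intro l _ hl
    rw [if_neg]
    rintro ⟨-, h⟩
    exact hl (Fin.ext h)
  · simp

theorem evalAt_X_inl {d : ℕ} (F : homogeneousSubmodule (Fin 2) ℂ d) (v : Fin 2 → ℂ)
    (k : Fin (d + 1)) : evalAt F v (X (Sum.inl k)) = formCoeff F k := by
  simp [evalAt, formCoeff]

theorem evalAt_X_inr {d : ℕ} (F : homogeneousSubmodule (Fin 2) ℂ d) (v : Fin 2 → ℂ)
    (k : Fin 2) : evalAt F v (X (Sum.inr k)) = v k := by
  simp [evalAt]

/-- Evaluations at all pairs `(F, v)` separate the elements of the coordinate ring. -/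
theorem eq_of_evalAt_eq {d : ℕ} {p q : CoordRing d}
    (h : ∀ (F : homogeneousSubmodule (Fin 2) ℂ d) v, evalAt F v p = evalAt F v q) : p = q := by
  refine MvPolynomial.funext fun x => ?_
  have hx : evalAt (formOf (x ∘ Sum.inl)) (x ∘ Sum.inr) = aeval x := by
    apply MvPolynomial.algHom_ext
    rintro (k | k)
    · rw [evalAt_X_inl, formCoeff_formOf, aeval_X]
      rfl
    · rw [evalAt_X_inr, aeval_X]
      rfl
  have := h (formOf (x ∘ Sum.inl)) (x ∘ Sum.inr)
  rw [hx] at this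
  simpa [aeval_eq_eval] using this

/-- The upper unipotent matrix with parameter `s`. -/
def upperUnipotent (s : ℂ) : SL(2, ℂ) := ⟨!![1, s; 0, 1], by simp⟩

/-- The lower unipotent matrix with parameter `s`. -/
def lowerUnipotent (s : ℂ) : SL(2, ℂ) := ⟨!![1, 0; s, 1], by simp⟩

theorem coe_upperUnipotent (s : ℂ) :
    (upperUnipotent s : Matrix (Fin 2) (Fin 2) ℂ) = !![1, s; 0, 1] :=
  rfl

theorem coe_lowerUnipotent (s : ℂ) :
    (lowerUnipotent s : Matrix (Fin 2) (Fin 2) ℂ) = !![1, 0; s, 1] :=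
  rfl

theorem coe_upperUnipotent_inv (s : ℂ) :
    ((upperUnipotent s)⁻¹ : SL(2, ℂ)).1 = !![1, -s; 0, 1] := by
  rw [Matrix.SpecialLinearGroup.coe_inv, coe_upperUnipotent, Matrix.adjugate_fin_two_of, neg_zero]

theorem coe_lowerUnipotent_inv (s : ℂ) :
    ((lowerUnipotent s)⁻¹ : SL(2, ℂ)).1 = !![1, 0; -s, 1] := by
  rw [Matrix.SpecialLinearGroup.coe_inv, coe_lowerUnipotent, Matrix.adjugate_fin_two_of, neg_zero]

theorem formRep_coe {d : ℕ} (g : SL(2, ℂ)) (F : homogeneousSubmodule (Fin 2) ℂ d) :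
    (formRep d g F : MvPolynomial (Fin 2) ℂ) =
      bind₁ (fun i : Fin 2 => ∑ j : Fin 2, C ((g⁻¹ : SL(2, ℂ)) i j) * X j)
        (F : MvPolynomial (Fin 2) ℂ) :=
  rfl

/-- The inverse matrix substitutes x - s y for x; the entries are the coefficients of x^(d-k) y^k in
(x - s y)^(d-l) y^l. -/
theorem formCoeff_upperUnipotent {d : ℕ} (s : ℂ) (F : homogeneousSubmodule (Fin 2) ℂ d)
    (k : Fin (d + 1)) : formCoeff (formRep d (upperUnipotent s) F) k =
      ∑ l : Fin (d + 1), ((d - l : ℕ).choose (d - k) : ℂ) * (-s) ^ ((k : ℕ) - l) *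
        formCoeff F l := by
  rw [formCoeff, formRep_coe, form_eq_sum F, map_sum, coeff_sum]
  refine Finset.sum_congr rfl fun l _ => ?_
  have h : ∀ n : ℕ, (X 0 + C (-s) * X 1 : MvPolynomial (Fin 2) ℂ) ^ n * X 1 ^ (l : ℕ) =
      ∑ m ∈ Finset.range (n + 1), C ((n.choose m : ℂ) * (-s) ^ (n - m)) *
        (X 0 ^ m * X 1 ^ (n - m + l)) := by
    intro n
    rw [add_pow, Finset.sum_mul]
    refine Finset.sum_congr rfl fun m _ => ?_
    rw [mul_pow, map_mul, map_pow, map_natCast]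
    ring
  have h₀ : (bind₁ (fun i : Fin 2 => ∑ j : Fin 2,
      C (((upperUnipotent s)⁻¹ : SL(2, ℂ)) i j) * X j))
        (C (formCoeff F l) * (X 0 ^ (d - l : ℕ) * X 1 ^ (l : ℕ)) : MvPolynomial (Fin 2) ℂ) =
      C (formCoeff F l) * ((X 0 + C (-s) * X 1) ^ (d - l : ℕ) * X 1 ^ (l : ℕ)) := by
    simp only [coe_upperUnipotent_inv]
    simp [Fin.sum_univ_two]
  rw [h₀, coeff_C_mul, h, coeff_sum]
  simp only [coeff_C_mul_X_pow_mul_X_pow]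
  rw [mul_comm]
  congr 1
  by_cases hkl : (l : ℕ) ≤ k
  · rw [Finset.sum_eq_single (d - k : ℕ)]
    · rw [if_pos (by omega), show d - (l : ℕ) - (d - k) = k - l by omega]
    · intro m _ hm
      rw [if_neg (by omega)]
    · intro hm
      rw [Finset.mem_range] at hm
      omega
  · rw [Nat.choose_eq_zero_of_lt (by omega), Nat.cast_zero, zero_mul]
    refine Finset.sum_eq_zero fun m hm => ?_
    rw [Finset.mem_range] at hm
    rw [if_neg (by omega)]

theorem formCoeff_lowerUnipotent {d : ℕ} (s : ℂ) (F : homogeneousSubmodule (Fin 2) ℂ d)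
    (k : Fin (d + 1)) : formCoeff (formRep d (lowerUnipotent s) F) k =
      ∑ l : Fin (d + 1), ((l : ℕ).choose k : ℂ) * (-s) ^ ((l : ℕ) - k) * formCoeff F l := by
  rw [formCoeff, formRep_coe, form_eq_sum F, map_sum, coeff_sum]
  refine Finset.sum_congr rfl fun l _ => ?_
  have h : ∀ n : ℕ, (X 0 ^ (d - l : ℕ) * (X 1 + C (-s) * X 0) ^ n : MvPolynomial (Fin 2) ℂ) =
      ∑ m ∈ Finset.range (n + 1), C ((n.choose m : ℂ) * (-s) ^ (n - m)) *
        (X 0 ^ (n - m + (d - l : ℕ)) * X 1 ^ m) := by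
    intro n
    rw [add_pow, Finset.mul_sum]
    refine Finset.sum_congr rfl fun m _ => ?_
    rw [mul_pow, map_mul, map_pow, map_natCast]
    ring
  have h₀ : (bind₁ (fun i : Fin 2 => ∑ j : Fin 2,
      C (((lowerUnipotent s)⁻¹ : SL(2, ℂ)) i j) * X j))
        (C (formCoeff F l) * (X 0 ^ (d - l : ℕ) * X 1 ^ (l : ℕ)) : MvPolynomial (Fin 2) ℂ) =
      C (formCoeff F l) * (X 0 ^ (d - l : ℕ) * (X 1 + C (-s) * X 0) ^ (l : ℕ)) := by
    simp only [coe_lowerUnipotent_inv]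
    simp [Fin.sum_univ_two, add_comm]
  rw [h₀, coeff_C_mul, h, coeff_sum]
  simp only [coeff_C_mul_X_pow_mul_X_pow]
  rw [mul_comm]
  congr 1
  by_cases hkl : (k : ℕ) ≤ l
  · rw [Finset.sum_eq_single (k : ℕ)]
    · rw [if_pos (by omega)]
    · intro m _ hm
      rw [if_neg (by omega)]
    · intro hm
      rw [Finset.mem_range] at hm
      omega
  · rw [Nat.choose_eq_zero_of_lt (by omega), Nat.cast_zero, zero_mul]
    refine Finset.sum_eq_zero fun m hm => ?_
    rw [Finset.mem_range] at hm
    rw [if_neg (by omega)]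

/-- Evaluation of a polynomial over `ℂ[V_d ⊕ ℂ²]` at a constant, as a `ℂ`-algebra map. -/
noncomputable def evalConst (d : ℕ) (s : ℂ) : Polynomial (CoordRing d) →ₐ[ℂ] CoordRing d :=
  (Polynomial.aeval (R := CoordRing d) (C s : CoordRing d)).restrictScalars ℂ

theorem evalConst_apply (d : ℕ) (s : ℂ) (P : Polynomial (CoordRing d)) :
    evalConst d s P = P.eval (C s) := by
  simp [evalConst, Polynomial.aeval_def, Polynomial.eval₂_eq_eval_map]

/-- Both sides are algebra homomorphisms in p, so the variables suffice. This identifies the group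
action with the generic substitution at parameter s. -/
theorem evalAt_upperUnipotent {d : ℕ} (s : ℂ) (F : homogeneousSubmodule (Fin 2) ℂ d)
    (v : Fin 2 → ℂ) (p : CoordRing d) :
    evalAt (formRep d (upperUnipotent s) F) ((upperUnipotent s).1.mulVec v) p =
      evalAt F v ((upperSubst d p).eval (C s)) := by
  have : evalAt (formRep d (upperUnipotent s) F) ((upperUnipotent s).1.mulVec v) =
      (evalAt F v).comp ((evalConst d s).comp (upperSubst d)) := by
    apply MvPolynomial.algHom_ext
    rintro (k | k)
    · rw [evalAt_X_inl, formCoeff_upperUnipotent, AlgHom.comp_apply, AlgHom.comp_apply,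
        evalConst_apply]
      simp only [upperSubst, aeval_X, Sum.elim_inl, Polynomial.eval_finsetSum, map_sum]
      refine Finset.sum_congr rfl fun l _ => ?_
      simp [evalAt_X_inl, ← algebraMap_eq]
    · rw [evalAt_X_inr, AlgHom.comp_apply, AlgHom.comp_apply, evalConst_apply]
      fin_cases k <;>
        simp [upperSubst, coe_upperUnipotent, evalAt_X_inr, ← algebraMap_eq, Matrix.mulVec,
          dotProduct, mul_comm s]
  rw [this, AlgHom.comp_apply, AlgHom.comp_apply, evalConst_apply]

theorem evalAt_lowerUnipotent {d : ℕ} (s : ℂ) (F : homogeneousSubmodule (Fin 2) ℂ d)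
    (v : Fin 2 → ℂ) (p : CoordRing d) :
    evalAt (formRep d (lowerUnipotent s) F) ((lowerUnipotent s).1.mulVec v) p =
      evalAt F v ((lowerSubst d p).eval (C s)) := by
  have : evalAt (formRep d (lowerUnipotent s) F) ((lowerUnipotent s).1.mulVec v) =
      (evalAt F v).comp ((evalConst d s).comp (lowerSubst d)) := by
    apply MvPolynomial.algHom_ext
    rintro (k | k)
    · rw [evalAt_X_inl, formCoeff_lowerUnipotent, AlgHom.comp_apply, AlgHom.comp_apply,
        evalConst_apply]
      simp only [lowerSubst, aeval_X, Sum.elim_inl, Polynomial.eval_finsetSum, map_sum]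
      refine Finset.sum_congr rfl fun l _ => ?_
      simp [evalAt_X_inl, ← algebraMap_eq]
    · rw [evalAt_X_inr, AlgHom.comp_apply, AlgHom.comp_apply, evalConst_apply]
      fin_cases k <;>
        simp [lowerSubst, coe_lowerUnipotent, evalAt_X_inr, ← algebraMap_eq, Matrix.mulVec,
          dotProduct, mul_comm s, add_comm]
  rw [this, AlgHom.comp_apply, AlgHom.comp_apply, evalConst_apply]

/-- `SL(2, ℂ)` is generated by its unipotent triangular matrices. -/
theorem unipotent_induction {P : SL(2, ℂ) → Prop} (hu : ∀ s, P (upperUnipotent s))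
    (hl : ∀ s, P (lowerUnipotent s)) (hm : ∀ g h, P g → P h → P (g * h)) (g : SL(2, ℂ)) :
    P g := by
  have key : ∀ g : SL(2, ℂ), g.1 1 0 ≠ 0 → P g := by
    intro g hg
    have hdet := g.2
    rw [Matrix.det_fin_two] at hdet
    -- The lower left entry fixes the middle factor, the two diagonal entries fix the outer ones,
    -- and the determinant takes care of the last entry.
    have : g = upperUnipotent ((g.1 0 0 - 1) / g.1 1 0) * lowerUnipotent (g.1 1 0) *
        upperUnipotent ((g.1 1 1 - 1) / g.1 1 0) := by
      apply Subtype.ext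
      rw [Matrix.SpecialLinearGroup.coe_mul, Matrix.SpecialLinearGroup.coe_mul,
        coe_upperUnipotent, coe_lowerUnipotent, coe_upperUnipotent, Matrix.mul_fin_two,
        Matrix.mul_fin_two, Matrix.eta_fin_two g.1]
      congr! <;> simp <;> field_simp
      · ring
      · linear_combination -hdet
      · ring
    rw [this]
    exact hm _ _ (hm _ _ (hu _) (hl _)) (hu _)
  by_cases hg : g.1 1 0 = 0
  · have hdet := g.2
    rw [Matrix.det_fin_two, hg] at hdet
    -- Adding the first row to the second puts the nonzero entry `g.1 0 0` in the lower left corner.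
    have h : g = lowerUnipotent (-1) * (lowerUnipotent 1 * g) := by
      have : lowerUnipotent (-1) * lowerUnipotent 1 = 1 := by
        apply Subtype.ext
        rw [Matrix.SpecialLinearGroup.coe_mul, coe_lowerUnipotent, coe_lowerUnipotent,
          Matrix.mul_fin_two, Matrix.SpecialLinearGroup.coe_one, Matrix.one_fin_two]
        simp
      rw [← mul_assoc, this, one_mul]
    rw [h]
    refine hm _ _ (hl _) (key _ ?_)
    have h₀ : g.1 0 0 ≠ 0 := by
      intro h₀
      simp [h₀] at hdet
    rw [Matrix.SpecialLinearGroup.coe_mul, coe_lowerUnipotent]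
    simpa [Matrix.mul_apply, Fin.sum_univ_two, hg] using h₀
  · exact key g hg

/-- Covariants are the polynomials killed by the infinitesimal action. -/
theorem mem_covariants_iff {d : ℕ} (p : CoordRing d) :
    p ∈ covariants d ↔ lowering d p = 0 ∧ raising d p = 0 := by
  rw [← invariant_iff_derivation_eq_zero (lowering d) (upperSubst d) (derivative_upperSubst_X d)
      (eval_zero_upperSubst_X d),
    ← invariant_iff_derivation_eq_zero (raising d) (lowerSubst d) (derivative_lowerSubst_X d)
      (eval_zero_lowerSubst_X d)]
  constructor
  · intro h
    refine ⟨fun s => eq_of_evalAt_eq fun F v => ?_, fun s => eq_of_evalAt_eq fun F v => ?_⟩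
    · rw [← evalAt_upperUnipotent]
      exact h _ F v
    · rw [← evalAt_lowerUnipotent]
      exact h _ F v
  · rintro ⟨h₁, h₂⟩ g
    induction g using unipotent_induction with
    | hu s =>
      intro F v
      rw [evalAt_upperUnipotent, h₁]
    | hl s =>
      intro F v
      rw [evalAt_lowerUnipotent, h₂]
    | hm g h hg hh =>
      intro F v
      rw [map_mul, Module.End.mul_apply, Matrix.SpecialLinearGroup.coe_mul,
        ← Matrix.mulVec_mulVec, hg, hh]

end

/-! ### Weight spaces and the dimension of the covariants. -/

section

open MvPolynomial

/-- Degree, order and torus weight of the coordinates. -/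
def triWeight (d : ℕ) : Fin (d + 1) ⊕ Fin 2 → ℕ × ℕ × ℤ :=
  Sum.elim (fun k => (1, 0, 2 * k - d)) ![(0, 1, 1), (0, 1, -1)]

/-- The torus weight space of the polynomials of degree `i` and order `j`. -/
noncomputable def weightSpace (d i j : ℕ) (w : ℤ) : Submodule ℂ (CoordRing d) :=
  weightedHomogeneousSubmodule ℂ (triWeight d) (i, j, w)

theorem weight_triWeight (d : ℕ) (s : Fin (d + 1) ⊕ Fin 2 →₀ ℕ) :
    Finsupp.weight (triWeight d) s =
      (∑ k, s (Sum.inl k), s (Sum.inr 0) + s (Sum.inr 1),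
        (∑ k : Fin (d + 1), (s (Sum.inl k) : ℤ) * (2 * k - d)) + s (Sum.inr 0) -
          s (Sum.inr 1)) := by
  rw [Finsupp.weight_apply, Finsupp.sum_fintype _ _ (by simp)]
  simp only [triWeight, Fintype.sum_sum_type, Sum.elim_inl, Sum.elim_inr, Fin.sum_univ_two]
  refine Prod.ext ?_ (Prod.ext ?_ ?_)
  · simp [Prod.fst_sum]
  · simp [Prod.fst_sum, Prod.snd_sum]
  · simp [Prod.snd_sum]
    ring

theorem weight_torusWeight (d : ℕ) (s : Fin (d + 1) ⊕ Fin 2 →₀ ℕ) :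
    Finsupp.weight (torusWeight d) s = (Finsupp.weight (triWeight d) s).2.2 := by
  rw [weight_triWeight, Finsupp.weight_apply, Finsupp.sum_fintype _ _ (by simp)]
  simp [torusWeight, Fintype.sum_sum_type, Fin.sum_univ_two]
  ring

theorem weight_bidegree (d : ℕ) (s : Fin (d + 1) ⊕ Fin 2 →₀ ℕ) :
    Finsupp.weight (Sum.elim (fun _ => (1, 0)) (fun _ => (0, 1)) :
      Fin (d + 1) ⊕ Fin 2 → ℕ × ℕ) s =
      ((Finsupp.weight (triWeight d) s).1, (Finsupp.weight (triWeight d) s).2.1) := by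
  rw [weight_triWeight, Finsupp.weight_apply, Finsupp.sum_fintype _ _ (by simp)]
  simp only [Fintype.sum_sum_type, Sum.elim_inl, Sum.elim_inr, Fin.sum_univ_two]
  refine Prod.ext ?_ ?_
  · simp [Prod.fst_sum]
  · simp [Prod.snd_sum]

/-- `weightOp` scales each monomial by its torus weight, and distinct integers stay distinct in ℂ.
So weight spaces serve both for counting monomials and as eigenspaces. -/
theorem mem_weightSpace_iff {d i j : ℕ} {w : ℤ} {p : CoordRing d} :
    p ∈ weightSpace d i j w ↔
      p ∈ weightedHomogeneousSubmodule ℂ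
        (Sum.elim (fun _ => (1, 0)) (fun _ => (0, 1)) : Fin (d + 1) ⊕ Fin 2 → ℕ × ℕ) (i, j) ∧
      weightOp d p = (w : ℂ) • p := by
  have hc := coeff_derivation_diagonal (weightOp d) (torusWeight d) (weightOp_X d) p
  rw [weightSpace, mem_weightedHomogeneousSubmodule, mem_weightedHomogeneousSubmodule]
  constructor
  · intro h
    refine ⟨fun s hs => ?_, ?_⟩
    · rw [weight_bidegree, h hs]
    · ext s
      rw [hc, coeff_smul, smul_eq_mul]
      by_cases hs : coeff s p = 0
      · simp [hs]
      · rw [weight_torusWeight, h hs]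
  · rintro ⟨h₁, h₂⟩ s hs
    have h₃ := h₁ hs
    rw [weight_bidegree, Prod.mk.injEq] at h₃
    refine Prod.ext h₃.1 (Prod.ext h₃.2 ?_)
    have h₄ := hc s
    rw [h₂, coeff_smul, smul_eq_mul, weight_torusWeight] at h₄
    exact (Int.cast_injective (mul_right_cancel₀ hs h₄)).symm

theorem isWeightedHomogeneous_X_of_eq {σ M : Type*} [AddCommMonoid M] {w : σ → M} {k : σ} {n : M}
    (h : w k = n) : IsWeightedHomogeneous w (X k : MvPolynomial σ ℂ) n :=
  h ▸ isWeightedHomogeneous_X ℂ w k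

theorem lowering_mem_weightSpace {d i j : ℕ} {w : ℤ} {p : CoordRing d}
    (hp : p ∈ weightSpace d i j w) : lowering d p ∈ weightSpace d i j (w - 2) := by
  have := isWeightedHomogeneous_derivation (w := triWeight d) (δ := (0, 0, -2)) (lowering d)
    ?_ hp
  · exact this
  · rintro (k | k)
    · rw [← formCoord_fin]
      obtain ⟨k, hk⟩ := k
      rcases k with _ | k
      · rw [lowering_formCoord_zero]
        exact isWeightedHomogeneous_zero _ _ _
      · simp only [lowering_formCoord_succ]
        have : formCoord d k = X (Sum.inl ⟨k, by omega⟩) := by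
          simp [formCoord, (Nat.lt_succ_self k).trans hk]
        rw [this]
        refine (weightedHomogeneousSubmodule ℂ _ _).smul_mem _ ?_
        refine isWeightedHomogeneous_X_of_eq ?_
        simp [triWeight]
        ring
    · fin_cases k
      · simp only [Fin.zero_eta, lowering_inr_zero]
        refine isWeightedHomogeneous_X_of_eq ?_
        simp [triWeight]
      · simp only [Fin.mk_one, lowering_inr_one]
        exact isWeightedHomogeneous_zero _ _ _

theorem raising_mem_weightSpace {d i j : ℕ} {w : ℤ} {p : CoordRing d}
    (hp : p ∈ weightSpace d i j w) : raising d p ∈ weightSpace d i j (w + 2) := by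
  have := isWeightedHomogeneous_derivation (w := triWeight d) (δ := (0, 0, 2)) (raising d)
    ?_ hp
  · exact this
  · rintro (k | k)
    · rw [← formCoord_fin, raising_formCoord]
      refine (weightedHomogeneousSubmodule ℂ _ _).smul_mem _ ?_
      rcases lt_or_ge (k + 1 : ℕ) (d + 1) with h | h
      · have : formCoord d (k + 1) = X (Sum.inl ⟨k + 1, h⟩) := by
          rw [formCoord, dif_pos h]
        rw [this]
        refine isWeightedHomogeneous_X_of_eq ?_
        simp [triWeight]
        ring
      · rw [formCoord_of_lt h]
        exact isWeightedHomogeneous_zero _ _ _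
    · fin_cases k
      · simp only [Fin.zero_eta, raising_inr_zero]
        exact isWeightedHomogeneous_zero _ _ _
      · simp only [Fin.mk_one, raising_inr_one]
        refine isWeightedHomogeneous_X_of_eq ?_
        simp [triWeight]

theorem lowering_pow_mem_weightSpace {d i j : ℕ} {w : ℤ} {p : CoordRing d}
    (hp : p ∈ weightSpace d i j w) (n : ℕ) :
    ((lowering d).toLinearMap ^ n) p ∈ weightSpace d i j (w - 2 * n) := by
  induction n with
  | zero => simpa using hp
  | succ n ih =>
    rw [pow_succ', Module.End.mul_apply]
    rw [show w - 2 * ((n + 1 : ℕ) : ℤ) = w - 2 * n - 2 by push_cast; ring]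
    exact lowering_mem_weightSpace ih

theorem raising_pow_mem_weightSpace {d i j : ℕ} {w : ℤ} {p : CoordRing d}
    (hp : p ∈ weightSpace d i j w) (n : ℕ) :
    ((raising d).toLinearMap ^ n) p ∈ weightSpace d i j (w + 2 * n) := by
  induction n with
  | zero => simpa using hp
  | succ n ih =>
    rw [pow_succ', Module.End.mul_apply]
    rw [show w + 2 * ((n + 1 : ℕ) : ℤ) = w + 2 * n + 2 by push_cast; ring]
    exact raising_mem_weightSpace ih

/-- Form coordinates have weights in [-d, d] and vector coordinates ±1, which bounds the weight of
every monomial. This makes both operators locally nilpotent. -/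
theorem eq_zero_of_mem_weightSpace {d i j : ℕ} {w : ℤ} {p : CoordRing d}
    (hp : p ∈ weightSpace d i j w) (hw : (d * i + j : ℤ) < |w|) : p = 0 := by
  ext s
  rw [coeff_zero]
  by_contra hs
  have h : Finsupp.weight (triWeight d) s = (i, j, w) := hp hs
  rw [weight_triWeight, Prod.mk.injEq, Prod.mk.injEq] at h
  obtain ⟨h₁, h₂, h₃⟩ := h
  have hb : |∑ k : Fin (d + 1), (s (Sum.inl k) : ℤ) * (2 * k - d)| ≤ d * i := by
    refine (Finset.abs_sum_le_sum_abs _ _).trans ?_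
    rw [← h₁, Nat.cast_sum, Finset.mul_sum]
    refine Finset.sum_le_sum fun k _ => ?_
    rw [abs_mul, Nat.abs_cast, mul_comm]
    refine mul_le_mul_of_nonneg_right ?_ (Nat.cast_nonneg _)
    rw [abs_le]
    omega
  rw [abs_le] at hb
  rw [lt_abs] at hw
  omega

theorem exists_lowering_pow_eq_zero {d i j : ℕ} {w : ℤ} {p : CoordRing d}
    (hp : p ∈ weightSpace d i j w) : ∃ n, ((lowering d).toLinearMap ^ n) p = 0 := by
  refine ⟨(w.toNat + d * i + j + 1), eq_zero_of_mem_weightSpace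
    (lowering_pow_mem_weightSpace hp _) ?_⟩
  rw [lt_abs]
  right
  have := Int.self_le_toNat w
  have : (0 : ℤ) ≤ d * i := by positivity
  push_cast
  omega

theorem exists_raising_pow_eq_zero {d i j : ℕ} {w : ℤ} {p : CoordRing d}
    (hp : p ∈ weightSpace d i j w) : ∃ n, ((raising d).toLinearMap ^ n) p = 0 := by
  refine ⟨((-w).toNat + d * i + j + 1), eq_zero_of_mem_weightSpace
    (raising_pow_mem_weightSpace hp _) ?_⟩
  rw [lt_abs]
  left
  have := Int.self_le_toNat (-w)
  have : (0 : ℤ) ≤ d * i := by positivity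
  push_cast
  omega

/-- A lowest weight vector of weight 0 spans a trivial representation. `lower_pow_eq_zero` is used
with `e` and `f` exchanged, `h` negated, and exponent 1, since μ = 0 differs from every n ≥ 1. -/
theorem raising_eq_zero_of_lowering_eq_zero {d i j : ℕ} {p : CoordRing d}
    (hp : p ∈ weightSpace d i j 0) (h : lowering d p = 0) : raising d p = 0 := by
  obtain ⟨N, hN⟩ := exists_raising_pow_eq_zero hp
  have := lower_pow_eq_zero (e := (lowering d).toLinearMap) (f := (raising d).toLinearMap)
    (h := -(weightOp d).toLinearMap) (x := p) (μ := 0) ?_ ?_ ?_ ?_ 1 ?_ hN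
  · simpa using this
  · intro x
    simpa using congrArg Neg.neg (raising_lowering_sub d x)
  · intro x
    have := congrArg Neg.neg (weightOp_raising_sub d x)
    simp only [LinearMap.neg_apply, Derivation.coeFn_coe, map_neg, neg_smul]
    rw [← this]
    abel
  · simpa using (mem_weightSpace_iff.1 hp).2
  · simp [h]
  · intro n hn h0
    have : n = 0 := by exact_mod_cast h0.symm
    omega

/-- Weight 0 is automatic for covariants, since `weightOp` is the commutator of the two operators
that kill them. -/
theorem covariantsPart_eq (d i j : ℕ) :
    covariantsPart d i j = weightSpace d i j 0 ⊓ LinearMap.ker (lowering d).toLinearMap := by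
  ext p
  rw [covariantsPart, Submodule.mem_inf, Submodule.mem_inf, Subalgebra.mem_toSubmodule,
    mem_covariants_iff, LinearMap.mem_ker]
  constructor
  · rintro ⟨⟨h₁, h₂⟩, h₃⟩
    refine ⟨mem_weightSpace_iff.2 ⟨h₃, ?_⟩, h₁⟩
    rw [← raising_lowering_sub, h₁, h₂]
    simp
  · rintro ⟨h₁, h₂⟩
    exact ⟨⟨h₂, raising_eq_zero_of_lowering_eq_zero h₁ h₂⟩, (mem_weightSpace_iff.1 h₁).1⟩

instance weightSpace_finiteDimensional (d i j : ℕ) (w : ℤ) :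
    FiniteDimensional ℂ (weightSpace d i j w) := by
  have hle : weightSpace d i j w ≤ weightedHomogeneousSubmodule ℂ
      (fun _ : Fin (d + 1) ⊕ Fin 2 => 1) (i + j) := by
    intro p hp s hs
    have h : Finsupp.weight (triWeight d) s = (i, j, w) := hp hs
    rw [weight_triWeight, Prod.mk.injEq, Prod.mk.injEq] at h
    rw [Finsupp.weight_apply, Finsupp.sum_fintype _ _ (by simp), Fintype.sum_sum_type,
      Fin.sum_univ_two, ← h.1, ← h.2.1]
    simp
  have : FiniteDimensional ℂ (weightedHomogeneousSubmodule ℂ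
      (fun _ : Fin (d + 1) ⊕ Fin 2 => 1) (i + j)) :=
    Module.Finite.iff_fg.mpr (weightedHomogeneousSubmodule_fg ℂ _ (fun _ => one_ne_zero) _)
  exact Submodule.finiteDimensional_of_le hle

/-- On the weight -2 space `lowering ∘ raising` is injective: for a vector p in its kernel,
`lower_pow_eq_zero` with exponent 0 gives p = 0, as -2 is not a natural number. Finite dimension
makes it surjective. -/
theorem map_lowering_weightSpace (d i j : ℕ) :
    (weightSpace d i j 0).map (lowering d).toLinearMap = weightSpace d i j (-2) := by
  apply le_antisymm
  · rintro _ ⟨p, hp, rfl⟩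
    exact lowering_mem_weightSpace hp
  · intro q hq
    let T : weightSpace d i j (-2) →ₗ[ℂ] weightSpace d i j (-2) :=
      ((lowering d).toLinearMap ∘ₗ (raising d).toLinearMap).restrict fun p hp => by
        simpa using lowering_mem_weightSpace (raising_mem_weightSpace hp)
    have hT : Function.Injective T := by
      rw [← LinearMap.ker_eq_bot, LinearMap.ker_eq_bot']
      rintro ⟨p, hp⟩ h
      have h' : lowering d (raising d p) = 0 := congrArg Subtype.val h
      obtain ⟨N, hN⟩ := exists_lowering_pow_eq_zero hp
      have := lower_pow_eq_zero (e := (raising d).toLinearMap) (f := (lowering d).toLinearMap)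
        (h := (weightOp d).toLinearMap) (x := p) (μ := -2) (raising_lowering_sub d)
        (weightOp_lowering_sub d) ?_ h' 0 ?_ hN
      · exact Subtype.ext this
      · simpa using (mem_weightSpace_iff.1 hp).2
      · intro n _ hn
        have : (n : ℝ) = -2 := by exact_mod_cast hn.symm
        have : (0 : ℝ) ≤ n := Nat.cast_nonneg n
        linarith
    obtain ⟨⟨p, hp⟩, h⟩ := LinearMap.injective_iff_surjective.1 hT ⟨q, hq⟩
    refine ⟨raising d p, raising_mem_weightSpace hp, ?_⟩
    exact congrArg Subtype.val h

theorem finrank_inf_ker_add_finrank_map {V : Type*} [AddCommGroup V] [Module ℂ V]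
    (A : Submodule ℂ V) [FiniteDimensional ℂ A] (f : V →ₗ[ℂ] V) :
    Module.finrank ℂ (A ⊓ LinearMap.ker f : Submodule ℂ V) + Module.finrank ℂ (A.map f) =
      Module.finrank ℂ A := by
  rw [← LinearMap.finrank_range_add_finrank_ker (f.domRestrict A), LinearMap.range_domRestrict,
    LinearMap.ker_domRestrict, ← Submodule.map_comap_subtype, Submodule.finrank_map_subtype_eq,
    add_comm]

theorem finrank_covariantsPart (d i j : ℕ) :
    (Module.finrank ℂ (covariantsPart d i j) : ℤ) =
      Module.finrank ℂ (weightSpace d i j 0) - Module.finrank ℂ (weightSpace d i j (-2)) := by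
  rw [covariantsPart_eq, ← map_lowering_weightSpace,
    ← finrank_inf_ker_add_finrank_map (weightSpace d i j 0) (lowering d).toLinearMap]
  push_cast
  ring

/-- The generating series of the exponent vectors of degree `i` in `d + 1` variables with
respect to `2 ∑ k m_k`. -/
noncomputable def tupleSeries (d i : ℕ) : PowerSeries ℤ :=
  ∑ m ∈ Finset.Nat.antidiagonalTuple (d + 1) i, PowerSeries.X ^ (2 * ∑ k : Fin (d + 1), (k : ℕ) * m k)

/-- A monomial is given by the exponents m of the form coordinates and the exponent b of the first
vector coordinate, the other being j - b. Weight -c then reads di + j = 2b + c + 2 ∑ k m_k. -/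
theorem finrank_weightSpace (d i j c : ℕ) {w : ℤ} (hwc : w = -c) :
    (Module.finrank ℂ (weightSpace d i j w) : ℤ) =
      PowerSeries.coeff (d * i + j)
        (∑ b ∈ Finset.range (j + 1), PowerSeries.X ^ (2 * b + c) * tupleSeries d i) := by
  subst hwc
  rw [weightSpace, finrank_weightedHomogeneousSubmodule]
  let S := (Finset.Nat.antidiagonalTuple (d + 1) i ×ˢ Finset.range (j + 1)).filter
    (fun x => d * i + j = 2 * x.2 + c + 2 * ∑ k : Fin (d + 1), (k : ℕ) * x.1 k)
  have hw : ∀ m : Fin (d + 1) → ℕ, ∑ k, m k = i →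
      (∑ k : Fin (d + 1), (m k : ℤ) * (2 * k - d)) = 2 * (∑ k : Fin (d + 1), (k : ℕ) * m k : ℕ) - d * i := by
    intro m hm
    rw [← hm]
    push_cast
    rw [Finset.mul_sum, Finset.mul_sum, ← Finset.sum_sub_distrib]
    exact Finset.sum_congr rfl fun k _ => by ring
  let e : {s : Fin (d + 1) ⊕ Fin 2 →₀ ℕ // Finsupp.weight (triWeight d) s = (i, j, -(c : ℤ))} ≃
      S :=
    { toFun := fun s => ⟨(fun k => s.1 (Sum.inl k), s.1 (Sum.inr 0)), by
        have h := s.2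
        rw [weight_triWeight, Prod.mk.injEq, Prod.mk.injEq] at h
        obtain ⟨h₁, h₂, h₃⟩ := h
        rw [hw (fun k => s.1 (Sum.inl k)) h₁] at h₃
        simp only [S, Finset.mem_filter, Finset.mem_product, Finset.mem_range,
          Finset.Nat.mem_antidiagonalTuple]
        refine ⟨⟨h₁, by omega⟩, ?_⟩
        zify at h₂ h₃ ⊢
        linarith⟩
      invFun := fun x => ⟨Finsupp.equivFunOnFinite.symm (Sum.elim x.1.1 ![x.1.2, j - x.1.2]), by
        obtain ⟨⟨m, b⟩, hx⟩ := x
        simp only [S, Finset.mem_filter, Finset.mem_product, Finset.mem_range,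
          Finset.Nat.mem_antidiagonalTuple] at hx
        obtain ⟨⟨h₁, h₂⟩, h₃⟩ := hx
        have h₄ := hw m h₁
        rw [weight_triWeight]
        simp only [Finsupp.equivFunOnFinite_symm_apply_apply, Sum.elim_inl, Sum.elim_inr,
          Matrix.cons_val_zero, Matrix.cons_val_one, h₁, h₄]
        refine Prod.ext rfl (Prod.ext ?_ ?_)
        · simp only
          omega
        · simp only
          rw [Nat.cast_sub (by omega)]
          zify at h₃ ⊢
          linarith⟩
      left_inv := by
        rintro ⟨s, h⟩
        rw [weight_triWeight, Prod.mk.injEq, Prod.mk.injEq] at h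
        apply Subtype.ext
        ext k
        rcases k with k | k
        · simp
        · fin_cases k
          · simp
          · simp
            omega
      right_inv := by
        rintro ⟨⟨m, b⟩, hx⟩
        apply Subtype.ext
        simp }
  rw [Nat.card_congr e, Nat.card_eq_fintype_card, Fintype.card_coe, Finset.card_filter,
    Finset.sum_product_right, map_sum]
  push_cast
  refine Finset.sum_congr rfl fun b _ => ?_
  rw [tupleSeries, Finset.mul_sum, map_sum]
  refine Finset.sum_congr rfl fun m _ => ?_
  rw [← pow_add, PowerSeries.coeff_X_pow]

/-- The series for weights 0 and -2 differ by a shift of b by one, so the difference telescopes. -/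
theorem finrank_covariantsPart_eq_coeff (d i j : ℕ) :
    (Module.finrank ℂ (covariantsPart d i j) : ℤ) =
      PowerSeries.coeff (d * i + j)
        ((1 - PowerSeries.X ^ (2 * j + 2)) * tupleSeries d i) := by
  have h₀ := finrank_weightSpace d i j 0 (w := 0) (by simp)
  have h₂ := finrank_weightSpace d i j 2 (w := -2) (by simp)
  rw [finrank_covariantsPart]
  rw [h₀, h₂, ← map_sub, ← Finset.sum_sub_distrib]
  congr 1
  have := Finset.sum_range_sub'
    (fun b => (PowerSeries.X ^ (2 * b) * tupleSeries d i : PowerSeries ℤ)) (j + 1)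
  simp only [mul_add, add_zero, mul_zero, pow_zero, one_mul, mul_one] at this ⊢
  rw [this]
  ring

end

/-! ### Gaussian binomials: Pascal recurrence and symmetry. -/

section TupleSeries

open PowerSeries

theorem tupleSeries_zero_right (d : ℕ) : tupleSeries d 0 = 1 := by
  simp [tupleSeries, Finset.Nat.antidiagonalTuple_zero_right]

theorem tupleSeries_zero_left (i : ℕ) : tupleSeries 0 i = 1 := by
  simp [tupleSeries, Finset.Nat.antidiagonalTuple_one]

/-- If m_0 ≠ 0, lowering it by one leaves ∑ k m_k unchanged. If m_0 = 0, dropping it shifts all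
indices down and reduces the sum by i + 1. -/
theorem tupleSeries_succ_succ (d i : ℕ) :
    tupleSeries (d + 1) (i + 1) =
      tupleSeries (d + 1) i + X ^ (2 * (i + 1)) * tupleSeries d (i + 1) := by
  have hs : ∀ m : Fin (d + 1 + 1) → ℕ, ∑ k : Fin (d + 1 + 1), (k : ℕ) * m k =
      ∑ k : Fin (d + 1), ((k : ℕ) + 1) * m k.succ := by
    intro m
    rw [Fin.sum_univ_succ]
    simp
  rw [tupleSeries, ← Finset.sum_filter_add_sum_filter_not _ (fun m => m 0 ≠ 0)]
  congr 1
  · rw [tupleSeries]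
    refine Finset.sum_nbij' (fun m => Fin.cons (m 0 - 1) (Fin.tail m))
      (fun m => Fin.cons (m 0 + 1) (Fin.tail m)) ?_ ?_ ?_ ?_ ?_
    · intro m hm
      rw [Finset.mem_filter, Finset.Nat.mem_antidiagonalTuple, Fin.sum_univ_succ] at hm
      rw [Finset.Nat.mem_antidiagonalTuple, Fin.sum_univ_succ]
      simp only [Fin.cons_zero, Fin.cons_succ, Fin.tail]
      omega
    · intro m hm
      rw [Finset.Nat.mem_antidiagonalTuple, Fin.sum_univ_succ] at hm
      rw [Finset.mem_filter, Finset.Nat.mem_antidiagonalTuple, Fin.sum_univ_succ]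
      simp only [Fin.cons_zero, Fin.cons_succ, Fin.tail]
      omega
    · intro m hm
      rw [Finset.mem_filter] at hm
      simp only [Fin.cons_zero, Fin.tail_cons]
      rw [Nat.sub_add_cancel (Nat.one_le_iff_ne_zero.2 hm.2), Fin.cons_self_tail]
    · intro m _
      simp only [Fin.cons_zero, Fin.tail_cons, Nat.add_sub_cancel, Fin.cons_self_tail]
    · intro m _
      rw [hs, hs]
      simp [Fin.tail]
  · rw [tupleSeries, Finset.mul_sum]
    refine Finset.sum_nbij' (fun m => Fin.tail m) (fun m => Fin.cons 0 m) ?_ ?_ ?_ ?_ ?_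
    · intro m hm
      rw [Finset.mem_filter, Finset.Nat.mem_antidiagonalTuple, Fin.sum_univ_succ, not_not] at hm
      rw [Finset.Nat.mem_antidiagonalTuple]
      simp only [Fin.tail]
      omega
    · intro m hm
      rw [Finset.Nat.mem_antidiagonalTuple] at hm
      rw [Finset.mem_filter, Finset.Nat.mem_antidiagonalTuple, Fin.sum_univ_succ]
      simp [hm]
    · intro m hm
      rw [Finset.mem_filter, not_not] at hm
      rw [← hm.2, Fin.cons_self_tail]
    · intro m _
      exact Fin.tail_cons _ _
    · intro m hm
      rw [Finset.mem_filter, Finset.Nat.mem_antidiagonalTuple, Fin.sum_univ_succ, not_not] at hm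
      have h₁ : ∑ k : Fin (d + 1), m k.succ = i + 1 := by omega
      rw [hs, ← pow_add, ← h₁]
      congr 1
      simp only [Fin.tail, add_mul, one_mul, Finset.sum_add_distrib]
      ring

theorem coeff_tupleSeries (d i n : ℕ) :
    coeff n (tupleSeries d i) = ((Finset.Nat.antidiagonalTuple (d + 1) i).filter
      (fun m => n = 2 * ∑ k : Fin (d + 1), (k : ℕ) * m k)).card := by
  rw [tupleSeries, map_sum, Finset.card_filter]
  push_cast
  exact Finset.sum_congr rfl fun m _ => coeff_X_pow _ _

theorem sum_mul_rev {d i : ℕ} {m : Fin (d + 1) → ℕ} (hm : ∑ k, m k = i) :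
    ∑ k : Fin (d + 1), (k : ℕ) * m k.rev + ∑ k : Fin (d + 1), (k : ℕ) * m k = d * i := by
  have : ∑ k : Fin (d + 1), (k : ℕ) * m k.rev = ∑ k : Fin (d + 1), (k.rev : ℕ) * m k := by
    rw [← Equiv.sum_comp Fin.revPerm]
    simp
  rw [this, ← Finset.sum_add_distrib, ← hm, Finset.mul_sum]
  refine Finset.sum_congr rfl fun k _ => ?_
  rw [← add_mul, Fin.val_rev]
  congr 1
  omega

/-- Reversing a tuple replaces ∑ k m_k by di - ∑ k m_k. -/
theorem coeff_tupleSeries_symm {d i n n' : ℕ} (h : n + n' = 2 * (d * i)) :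
    coeff n (tupleSeries d i) = coeff n' (tupleSeries d i) := by
  rw [coeff_tupleSeries, coeff_tupleSeries]
  have key : ∀ (n n' : ℕ), n + n' = 2 * (d * i) → ∀ m ∈
      (Finset.Nat.antidiagonalTuple (d + 1) i).filter
        (fun m => n = 2 * ∑ k : Fin (d + 1), (k : ℕ) * m k),
      m ∘ Fin.rev ∈ (Finset.Nat.antidiagonalTuple (d + 1) i).filter
        (fun m => n' = 2 * ∑ k : Fin (d + 1), (k : ℕ) * m k) := by
    intro n n' h m hm
    rw [Finset.mem_filter, Finset.Nat.mem_antidiagonalTuple] at hm ⊢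
    have h₁ := sum_mul_rev hm.1
    refine ⟨?_, ?_⟩
    · rw [← hm.1]
      exact Equiv.sum_comp Fin.revPerm m
    · simp only [Function.comp_apply]
      omega
  congr 1
  refine Finset.card_nbij' (fun m => m ∘ Fin.rev) (fun m => m ∘ Fin.rev)
    (key n n' h) (key n' n (by omega)) ?_ ?_
  · intro m _
    funext k
    simp
  · intro m _
    funext k
    simp

theorem coeff_tupleSeries_eq_zero {d i n : ℕ} (h : 2 * (d * i) < n) :
    coeff n (tupleSeries d i) = 0 := by
  rw [coeff_tupleSeries, Finset.filter_eq_empty_iff.2, Finset.card_empty, Nat.cast_zero]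
  intro m hm
  rw [Finset.Nat.mem_antidiagonalTuple] at hm
  have := sum_mul_rev hm
  omega

/-- The symmetry about di moves di + j to di - j, while di + j - (2j + 2) is already di - j - 2. -/
theorem coeff_one_sub_mul_tupleSeries (d i j : ℕ) :
    coeff (d * i + j) ((1 - X ^ (2 * j + 2)) * tupleSeries d i) =
      if j ≤ d * i then coeff (d * i - j) ((1 - X ^ 2) * tupleSeries d i) else 0 := by
  rw [sub_mul, sub_mul, one_mul, map_sub, map_sub, coeff_X_pow_mul', coeff_X_pow_mul']
  split_ifs with h₁ h₂ h₃ h₃ h₂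
  · rw [coeff_tupleSeries_symm (n' := d * i - j) (by omega)]
    congr 3
    omega
  · omega
  · omega
  · omega
  · rw [coeff_tupleSeries_symm (n' := d * i - j) (by omega)]
  · rw [coeff_tupleSeries_eq_zero (by omega), sub_zero]

end TupleSeries

/-! ### Partial fractions in z. -/

section PartialFractions

open PowerSeries

/-- The coefficients of the partial fraction decomposition of `∏ 1 / (1 - z t ^ (2 k))`. -/
noncomputable def residue (d k : ℕ) : PowerSeries ℤ :=
  (-1) ^ k * X ^ (k * (k + 1)) *
    invOfUnit (qShiftedFactorial (X ^ 2) (X ^ 2) k * qShiftedFactorial (X ^ 2) (X ^ 2) (d - k)) 1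

theorem qShiftedFactorial_ne_zero (n : ℕ) :
    qShiftedFactorial (X ^ 2 : PowerSeries ℤ) (X ^ 2) n ≠ 0 := by
  intro h
  have := constantCoeff_qShiftedFactorial n
  rw [h] at this
  simp at this

theorem qShiftedFactorial_succ (n : ℕ) :
    qShiftedFactorial (X ^ 2 : PowerSeries ℤ) (X ^ 2) (n + 1) =
      qShiftedFactorial (X ^ 2) (X ^ 2) n * (1 - X ^ (2 * (n + 1))) := by
  rw [qShiftedFactorial, Finset.prod_range_succ, ← qShiftedFactorial]
  ring

theorem residue_mul (d k : ℕ) :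
    residue d k * (qShiftedFactorial (X ^ 2) (X ^ 2) k *
      qShiftedFactorial (X ^ 2) (X ^ 2) (d - k)) = (-1) ^ k * X ^ (k * (k + 1)) := by
  rw [residue, mul_assoc, invOfUnit_mul, mul_one]
  simp [constantCoeff_qShiftedFactorial]

theorem residue_succ_left {d k : ℕ} (hk : k ≤ d) :
    residue (d + 1) k * (1 - X ^ (2 * (d + 1 - k))) = residue d k := by
  apply mul_right_cancel₀ (mul_ne_zero (qShiftedFactorial_ne_zero k)
    (qShiftedFactorial_ne_zero (d - k)))
  rw [residue_mul, ← residue_mul (d + 1) k, Nat.sub_add_comm hk, qShiftedFactorial_succ]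
  ring

theorem residue_succ_succ (d k : ℕ) :
    residue (d + 1) (k + 1) * (1 - X ^ (2 * (k + 1))) = -X ^ (2 * (k + 1)) * residue d k := by
  apply mul_right_cancel₀ (mul_ne_zero (qShiftedFactorial_ne_zero k)
    (qShiftedFactorial_ne_zero (d - k)))
  have h₁ := residue_mul d k
  have h₂ := residue_mul (d + 1) (k + 1)
  rw [Nat.add_sub_add_right, qShiftedFactorial_succ] at h₂
  rw [mul_assoc (-X ^ (2 * (k + 1))), h₁]
  calc _ = _ := by ring
    _ = _ := h₂
    _ = _ := by ring

/-- The sums of the expanded partial fractions. -/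
noncomputable def residueSum (d i : ℕ) : PowerSeries ℤ :=
  ∑ k ∈ Finset.range (d + 1), residue d k * X ^ (2 * (k * i))

theorem residueSum_zero_left (i : ℕ) : residueSum 0 i = 1 := by
  have := residue_mul 0 0
  simpa [residueSum, qShiftedFactorial] using this

/-- In the difference between i + 1 and i the k = 0 term cancels, and the factor 1 - t^(2k) in the
others is absorbed by `residue_succ_succ`. This is the recurrence of `tupleSeries`. -/
theorem residueSum_succ_succ (d i : ℕ) :
    residueSum (d + 1) (i + 1) = residueSum (d + 1) i + X ^ (2 * (i + 1)) * residueSum d (i + 1) := by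
  rw [← sub_eq_iff_eq_add', residueSum, residueSum, ← Finset.sum_sub_distrib,
    Finset.sum_range_succ', residueSum, Finset.mul_sum]
  simp only [zero_mul, sub_self, add_zero]
  refine Finset.sum_congr rfl fun k _ => ?_
  have := residue_succ_succ d k
  linear_combination (-X ^ (2 * ((k + 1) * i))) * this

/-- The dual Pascal rule: here the top term k = d + 1 cancels. It serves to find the initial value
at i = 0. -/
theorem residueSum_succ_succ' (d i : ℕ) :
    residueSum (d + 1) (i + 1) = residueSum d (i + 1) + X ^ (2 * (d + 1)) * residueSum (d + 1) i := by
  rw [← sub_eq_iff_eq_add, residueSum, residueSum, Finset.mul_sum, ← Finset.sum_sub_distrib,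
    Finset.sum_range_succ, residueSum]
  have h₀ : residue (d + 1) (d + 1) * X ^ (2 * ((d + 1) * (i + 1))) -
      X ^ (2 * (d + 1)) * (residue (d + 1) (d + 1) * X ^ (2 * ((d + 1) * i))) = 0 := by ring
  rw [h₀, add_zero]
  refine Finset.sum_congr rfl fun k hk => ?_
  have hk' : k ≤ d := Nat.lt_succ_iff.1 (Finset.mem_range.1 hk)
  obtain ⟨c, rfl⟩ := Nat.exists_eq_add_of_le hk'
  have := residue_succ_left hk'
  rw [show k + c + 1 - k = c + 1 by omega] at this
  rw [← this]
  ring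

theorem one_sub_X_pow_ne_zero {n : ℕ} (hn : n ≠ 0) : (1 - X ^ n : PowerSeries ℤ) ≠ 0 := by
  intro h
  have := congrArg constantCoeff h
  simp [hn] at this

/-- Equating the two recurrences at i = 0 expresses `residueSum (d + 1) 0` through `residueSum d 1`,
so the values at 0 and 1 are carried through the induction together. -/
theorem residueSum_zero_right (d : ℕ) :
    residueSum d 0 = 1 ∧ residueSum d 1 * (1 - X ^ 2) = 1 - X ^ (2 * (d + 1)) := by
  induction d with
  | zero => simp [residueSum_zero_left]
  | succ d ih =>
    have h₁ := residueSum_succ_succ d 0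
    have h₂ := residueSum_succ_succ' d 0
    simp only [zero_add, mul_one] at h₁ h₂
    have h₃ : residueSum (d + 1) 0 = 1 := by
      apply mul_right_cancel₀ (one_sub_X_pow_ne_zero (n := 2 * (d + 1)) (by omega))
      linear_combination ih.2 + h₂ - h₁
    refine ⟨h₃, ?_⟩
    rw [h₂, h₃]
    linear_combination ih.2

theorem tupleSeries_eq_residueSum (d i : ℕ) : tupleSeries d i = residueSum d i := by
  induction d generalizing i with
  | zero => rw [tupleSeries_zero_left, residueSum_zero_left]
  | succ d ihd =>
    induction i with
    | zero => rw [tupleSeries_zero_right, (residueSum_zero_right _).1]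
    | succ i ihi => rw [tupleSeries_succ_succ, residueSum_succ_succ, ihi, ihd]

end PartialFractions

/-! ### From the map ψ to the final formula. -/

/-- Multiplication by z t^n moves (i, j) to (i + 1, j + n) and preserves ni - j. The geometric
series thus removes the restriction j < n from ψ_n. -/
theorem psi_mul_invOfUnit {n : ℕ} (hn : n ≠ 0) (R : PowerSeries ℤ) :
    psi n R * MvPowerSeries.invOfUnit
        (1 - MvPowerSeries.X 0 * MvPowerSeries.X 1 ^ n : MvPowerSeries (Fin 2) ℤ) 1 =
      (fun m => if m 1 ≤ n * m 0 then PowerSeries.coeff (n * m 0 - m 1) R else 0 :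
        MvPowerSeries (Fin 2) ℤ) := by
  let G : MvPowerSeries (Fin 2) ℤ :=
    fun m => if m 1 ≤ n * m 0 then PowerSeries.coeff (n * m 0 - m 1) R else 0
  have hGc : ∀ m, MvPowerSeries.coeff m G =
    if m 1 ≤ n * m 0 then PowerSeries.coeff (n * m 0 - m 1) R else 0 := fun m => rfl
  have h : psi n R = G * (1 - MvPowerSeries.X 0 * MvPowerSeries.X 1 ^ n) := by
    ext m
    rw [mul_sub, mul_one, map_sub, ← pow_one (MvPowerSeries.X (0 : Fin 2)),
      MvPowerSeries.X_pow_eq, MvPowerSeries.X_pow_eq, MvPowerSeries.monomial_mul_monomial,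
      MvPowerSeries.coeff_mul_monomial, coeff_psi, hGc, hGc]
    have hle : (Finsupp.single 0 1 + Finsupp.single 1 n : Fin 2 →₀ ℕ) ≤ m ↔ 1 ≤ m 0 ∧ n ≤ m 1 := by
      rw [Finsupp.le_def, Fin.forall_fin_two]
      simp
    simp only [hle]
    by_cases h₁ : n ≤ m 1
    · rw [if_neg (fun h => absurd h.1 (not_lt.2 h₁))]
      rcases Nat.eq_zero_or_pos (m 0) with h₀ | h₀
      · rw [if_neg (by rw [h₀]; omega), if_neg (by omega), sub_zero]
      · obtain ⟨a, ha⟩ : ∃ a, m 0 = 1 + a := Nat.exists_eq_add_of_le h₀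
        have e₀ : (m - (Finsupp.single 0 1 + Finsupp.single 1 n) : Fin 2 →₀ ℕ) 0 = a := by
          simp [ha]
        have e₁ : (m - (Finsupp.single 0 1 + Finsupp.single 1 n) : Fin 2 →₀ ℕ) 1 = m 1 - n := by
          simp
        rw [if_pos (c := 1 ≤ m 0 ∧ n ≤ m 1) ⟨h₀, h₁⟩, e₀, e₁, ha, Nat.mul_add, Nat.mul_one,
          one_mul, mul_one,
          show n + n * a - m 1 = n * a - (m 1 - n) by omega,
          if_congr (show m 1 ≤ n + n * a ↔ m 1 - n ≤ n * a by omega) rfl rfl, sub_self]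
    · rw [if_neg (c := 1 ≤ m 0 ∧ n ≤ m 1) (fun h => h₁ h.2), sub_zero]
      simp only [not_le.1 h₁, true_and]
  rw [h, mul_assoc, MvPowerSeries.mul_invOfUnit, mul_one]
  simp

theorem theorem3 (d : ℕ) (hd : 1 ≤ d) :
    poincareSeries d =
      ∑ k ∈ (Finset.range d).filter (fun k => 2 * k < d),
        psi (d - 2 * k)
          ((-1) ^ k * PowerSeries.X ^ (k * (k + 1)) * (1 - PowerSeries.X ^ 2) *
            PowerSeries.invOfUnit
              (qShiftedFactorial (PowerSeries.X ^ 2) (PowerSeries.X ^ 2) k *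
                qShiftedFactorial (PowerSeries.X ^ 2) (PowerSeries.X ^ 2) (d - k)) 1) *
          MvPowerSeries.invOfUnit
            (1 - MvPowerSeries.X 0 * MvPowerSeries.X 1 ^ (d - 2 * k)) 1 := by
  have hR : ∀ k, (-1) ^ k * PowerSeries.X ^ (k * (k + 1)) * (1 - PowerSeries.X ^ 2) *
      PowerSeries.invOfUnit (qShiftedFactorial (PowerSeries.X ^ 2) (PowerSeries.X ^ 2) k *
        qShiftedFactorial (PowerSeries.X ^ 2) (PowerSeries.X ^ 2) (d - k)) 1 =
      (1 - PowerSeries.X ^ 2) * residue d k := by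
    intro k
    rw [residue]
    ring
  simp only [hR]
  ext m
  rw [map_sum]
  have hterm : ∀ k ∈ (Finset.range d).filter (fun k => 2 * k < d),
      MvPowerSeries.coeff m (psi (d - 2 * k) ((1 - PowerSeries.X ^ 2) * residue d k) *
        MvPowerSeries.invOfUnit (1 - MvPowerSeries.X 0 * MvPowerSeries.X 1 ^ (d - 2 * k)) 1) =
      if m 1 ≤ (d - 2 * k) * m 0 then PowerSeries.coeff ((d - 2 * k) * m 0 - m 1)
        ((1 - PowerSeries.X ^ 2) * residue d k) else 0 := by
    intro k hk
    rw [psi_mul_invOfUnit (by have := (Finset.mem_filter.1 hk).2; omega)]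
    rfl
  rw [Finset.sum_congr rfl hterm]
  change (Module.finrank ℂ (covariantsPart d (m 0) (m 1)) : ℤ) = _
  rw [finrank_covariantsPart_eq_coeff, coeff_one_sub_mul_tupleSeries, tupleSeries_eq_residueSum]
  generalize m 0 = i
  generalize m 1 = j
  have hmul : ∀ k, (d - 2 * k) * i = d * i - 2 * (k * i) := fun k => by
    rw [Nat.sub_mul, mul_assoc]
  split_ifs with hj
  · rw [residueSum, Finset.mul_sum, map_sum]
    symm
    have hsub : (Finset.range d).filter (fun k => 2 * k < d) ⊆ Finset.range (d + 1) := by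
      intro k hk
      rw [Finset.mem_filter, Finset.mem_range] at hk
      exact Finset.mem_range.2 (by omega)
    have hcomm : ∀ k, (1 - PowerSeries.X ^ 2) * (residue d k * PowerSeries.X ^ (2 * (k * i))) =
        PowerSeries.X ^ (2 * (k * i)) * ((1 - PowerSeries.X ^ 2) * residue d k) := fun k => by
      ring
    -- The terms with 2k ≥ d contribute nothing: they are divisible by t^(2ki + k(k+1)), an exponent
    -- above di - j.
    refine Finset.sum_subset_zero_on_sdiff hsub ?_ ?_
    · intro k hk
      rw [Finset.mem_sdiff, Finset.mem_filter, Finset.mem_range, Finset.mem_range] at hk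
      have hk2 : d ≤ 2 * k := by omega
      have hX : (1 - PowerSeries.X ^ 2) * (residue d k * PowerSeries.X ^ (2 * (k * i))) =
          PowerSeries.X ^ (2 * (k * i) + k * (k + 1)) * ((1 - PowerSeries.X ^ 2) * ((-1) ^ k *
            PowerSeries.invOfUnit (qShiftedFactorial (PowerSeries.X ^ 2) (PowerSeries.X ^ 2) k *
              qShiftedFactorial (PowerSeries.X ^ 2) (PowerSeries.X ^ 2) (d - k)) 1)) := by
        rw [residue]
        ring
      rw [hX, PowerSeries.coeff_X_pow_mul', if_neg]
      have h₁ : d * i ≤ 2 * k * i := Nat.mul_le_mul_right i hk2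
      rw [mul_assoc] at h₁
      -- As d ≥ 1, k is positive; this strictness is what settles 2k = d, where 2ki = di.
      have h₂ : 0 < k * (k + 1) := Nat.mul_pos (by omega) (by omega)
      omega
    · intro k _
      rw [hcomm, PowerSeries.coeff_X_pow_mul', hmul]
      rw [show d * i - 2 * (k * i) - j = d * i - j - 2 * (k * i) by omega]
      have h₀ : 2 * k < d := by
        have := (Finset.mem_filter.1 ‹_›).2
        omega
      have h₁ : 2 * k * i ≤ d * i := Nat.mul_le_mul_right i h₀.le
      rw [mul_assoc] at h₁
      exact if_congr (by omega) rfl rfl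
  · symm
    refine Finset.sum_eq_zero fun k _ => ?_
    rw [if_neg]
    rw [hmul]
    omega
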